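/- Let $X$ be a complex Banach space. A tetrahedral polynomial $P:\mathbb{C}^n\to X$ is a function of the form $P(z)=\sum_{A\subseteq\{1,\dots,n\}} x_A\prod_{k\in A}z_k$ with $x_A\in X$; its degree is the maximum of $|A|$ over all $A$ with $x_A\neq 0$ (and $0$ if $P=0$). Let $w=(w_1,\dots,w_n)$ denote a vector of independent Steinhaus variables, i.e. random variables uniformly distributed on the unit circle $\{z\in\mathbb{C}:|z|=1\}$. For $2\le q<\infty$, $X$ has cotype $q$ if there is $C\ge 1$ such that $\big(\sum_{i=1}^n\|x_i\|^q\big)^{1/q}\le C\big(\mathbb{E}\|\sum_{i=1}^n\varepsilon_i x_i\|^q\big)^{1/q}$ for all $n$ and all $x_1,\dots,x_n\in X$, where $\varepsilon_1,\dots,\varepsilon_n$ are independent Rademacher (uniform $\pm1$) variables; $X$ has non-trivial cotype if it has cotype $q$ for some $2\le q<\infty$, and $\cot(X)$ is the infimum of all such $q$. Let $\xi_0$ be a complex-valued random variable that is symmetric ($\xi_0$ and $-\xi_0$ have the same distribution) and non-trivial (not almost surely $0$), and let $\xi=(\xi_1,\dots,\xi_n)$ denote a random vector whose coordinates are independent copies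 of $\xi_0$. The $p$-norms below take values in $[0,\infty]$. (a) There is a constant $C\ge 1$ (depending only on $X$ and $\xi_0$) such that $$\big(\mathbb{E}\|P(w)\|^p\big)^{1/p}\le C^m\big(\mathbb{E}\|P(\xi)\|^p\big)^{1/p}$$ for every $1\le p<\infty$, every $n$, and every tetrahedral polynomial $P:\mathbb{C}^n\to X$ of degree $m$. (b) If $X$ has non-trivial cotype, $\mathbb{E}|\xi_0|^s<\infty$ for some real $s>\cot(X)$, and $1\le p<s$, then there is a constant $C\ge 1$ (depending only on $X$, $\xi_0$, $s$ and $p$) such that $$\big(\mathbb{E}\|P(\xi)\|^p\big)^{1/p}\le C^m\big(\mathbb{E}\|P(w)\|^p\big)^{1/p}$$ for every $n$ and every tetrahedral polynomial $P:\mathbb{C}^n\to X$ of degree $m$. -/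

import Mathlib

open MeasureTheory ProbabilityTheory
open scoped NNReal ENNReal

noncomputable section

namespace RandomPoly

/-- A tetrahedral polynomial `P(z) = ∑_{A ⊆ [n]} x_A ∏_{k ∈ A} z_k` in `n` complex variables
with values in `X`, given by its coefficients `x_A`. -/
abbrev TetrahedralPolynomial (n : ℕ) (X : Type*) := Finset (Fin n) → X

namespace TetrahedralPolynomial

/-- The value `P(z) = ∑_{A ⊆ [n]} x_A z_A`, where `z_A = ∏_{k ∈ A} z_k`. -/
def eval {n : ℕ} {X : Type*} [NormedAddCommGroup X] [NormedSpace ℂ X]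
    (P : TetrahedralPolynomial n X) (z : Fin n → ℂ) : X :=
  ∑ A : Finset (Fin n), (∏ k ∈ A, z k) • P A

open Classical in
/-- The degree: the maximum of `|A|` over all `A` with `x_A ≠ 0` (and `0` if `P = 0`). -/
def degree {n : ℕ} {X : Type*} [NormedAddCommGroup X] (P : TetrahedralPolynomial n X) : ℕ :=
  (Finset.univ.filter fun A : Finset (Fin n) => P A ≠ 0).sup Finset.card

end TetrahedralPolynomial

/-- The uniform probability distribution on the unit circle, as a measure on `ℂ`. -/
def steinhausLaw : Measure ℂ :=
  (volume.restrict (Set.Icc (0 : ℝ) 1)).map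
    fun t : ℝ => Complex.exp (2 * Real.pi * Complex.I * t)

/-- `w = (w₁, …, wₙ)` is a vector of independent Steinhaus variables. -/
def IsSteinhausVector {Ω : Type*} [MeasurableSpace Ω] (μ : Measure Ω) {n : ℕ}
    (w : Fin n → Ω → ℂ) : Prop :=
  iIndepFun w μ ∧ ∀ i, HasLaw (w i) steinhausLaw μ

/-- `ξ = (ξ₁, …, ξₙ)` is a vector of independent copies of the random variable `ξ₀`. -/
def IsIIDCopies {Ω₀ Ω : Type*} [MeasurableSpace Ω₀] [MeasurableSpace Ω]
    (μ₀ : Measure Ω₀) (ξ₀ : Ω₀ → ℂ) (μ : Measure Ω) {n : ℕ} (ξ : Fin n → Ω → ℂ) : Prop :=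
  iIndepFun ξ μ ∧ ∀ i, IdentDistrib (ξ i) ξ₀ μ μ₀

/-- The random variable `ξ₀` is symmetric: `ξ₀` and `-ξ₀` have the same distribution. -/
def IsSymmetricRV {Ω₀ : Type*} [MeasurableSpace Ω₀] (μ₀ : Measure Ω₀) (ξ₀ : Ω₀ → ℂ) : Prop :=
  IdentDistrib ξ₀ (fun ω => -ξ₀ ω) μ₀ μ₀

/-- The `p`-norm `(𝔼‖P(ξ)‖^p)^{1/p} ∈ [0, ∞]` of `P` evaluated at the random vector `ξ`. -/
def polyNorm {Ω : Type*} [MeasurableSpace Ω] (μ : Measure Ω) {n : ℕ} {X : Type*}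
    [NormedAddCommGroup X] [NormedSpace ℂ X] (p : ℝ) (P : TetrahedralPolynomial n X)
    (ξ : Fin n → Ω → ℂ) : ℝ≥0∞ :=
  (∫⁻ ω, ‖P.eval fun i => ξ i ω‖ₑ ^ p ∂μ) ^ (1 / p)

/-- The moment `𝔼‖∑ εᵢ xᵢ‖^q` over independent Rademacher variables `ε₁, …, εₙ`, that is, the
average over all `2 ^ n` choices of signs. -/
def rademacherMoment {X : Type*} [NormedAddCommGroup X] (q : ℝ) {n : ℕ} (x : Fin n → X) : ℝ :=
  (∑ ε : Fin n → ℤˣ, ‖∑ i, ((ε i : ℤ) • x i)‖ ^ q) / 2 ^ n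

/-- `X` has cotype `q`, where `2 ≤ q < ∞`. -/
def HasCotype (X : Type*) [NormedAddCommGroup X] (q : ℝ) : Prop :=
  2 ≤ q ∧ ∃ C : ℝ, 1 ≤ C ∧ ∀ (n : ℕ) (x : Fin n → X),
    (∑ i, ‖x i‖ ^ q) ^ (1 / q) ≤ C * (rademacherMoment q x) ^ (1 / q)

/-- `X` has cotype `q` for some `2 ≤ q < ∞`. -/
def HasNontrivialCotype (X : Type*) [NormedAddCommGroup X] : Prop :=
  ∃ q : ℝ, HasCotype X q

/-- `cot(X)`, the infimum of all `q` such that `X` has cotype `q`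
(only meaningful if `X` has non-trivial cotype). -/
def cot (X : Type*) [NormedAddCommGroup X] : ℝ :=
  sInf {q : ℝ | HasCotype X q}

end RandomPoly

end

noncomputable section

namespace RandomPoly

open TetrahedralPolynomial

/-! ### Extrapolation of polynomials from the unit interval -/

/-! Everything rests on a contraction principle (`eLpNorm'_eval_mul_le`): for independent variables
with a common symmetric law, multiplying the coordinates by complex numbers of modulus at most `R`
costs a factor `c(R) ^ m`, with `c(R)` independent of `p` and of the law. For real multipliers in
[-1, 1] the factor is 1: a tetrahedral polynomial is affine in each variable, so P(r u) is an
average of P(σ u) over signs σ. Complex multipliers follow by extrapolating polynomials of degree at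
most m from [0, 1] to a complex point, and the price is exponential in m.

Part (a), `eLpNorm'_eval_unimodular_le`: let δ = 𝔼 min(|ξ₀|, 1) > 0. By independence and Jensen's
inequality, P(δ w) is dominated by P evaluated at min(|ξᵢ|, 1) wᵢ. Contraction in w replaces
min(|ξᵢ|, 1) by ξᵢ, contraction in ξ removes the unimodular wᵢ, and a last contraction removes δ.

Part (b) reduces to linear sums. The homogeneous parts of P are extracted with roots of unity. A
k-homogeneous polynomial is an average, up to the factor k^k / k! ≤ 3^k, of its rainbow parts over
colourings of the variables by k colours. A rainbow part is linear in the variables of each colour,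
so the law can be changed one colour at a time, at the price K^k.

The linear comparison is where cotype enters. The key is `multNorm_selector_le`: random selectors of
mean at most τ shrink the L_r norm of ∑ wᵢ xᵢ by a factor of order τ^(1/r), because about 1/τ
independent copies of them are nearly disjoint and cotype adds up their contributions. Summing over
dyadic annuli of |ξ₀|, with tails controlled by the s-th moment, gives a geometric series that
converges for r < s. Kahane's inequality, proved by hypercontractivity, then passes from L_r to L_p.
-/

lemma prod_abs_sub_eq_factorial {m j : ℕ} (hj : j ≤ m) :
    ∏ k ∈ (Finset.range (m + 1)).erase j, |(j : ℝ) - k| =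
      (j.factorial : ℝ) * (m - j).factorial := by
  have h1 : (Finset.range (m + 1)).erase j = Finset.range j ∪ Finset.Ico (j + 1) (m + 1) := by
    ext k; simp; omega
  have h2 : Disjoint (Finset.range j) (Finset.Ico (j + 1) (m + 1)) := by
    rw [Finset.disjoint_left]; intro k; simp; omega
  rw [h1, Finset.prod_union h2]
  congr 1
  · rw [← Finset.prod_range_reflect, ← Finset.prod_range_add_one_eq_factorial, Nat.cast_prod]
    refine Finset.prod_congr rfl fun k hk => ?_
    have hk' := Finset.mem_range.1 hk
    have : ((j - 1 - k : ℕ) : ℝ) = j - 1 - k := by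
      rw [Nat.sub_sub, Nat.cast_sub (by omega)]; push_cast; ring
    rw [this, abs_of_nonneg] <;> push_cast <;> [ring; skip]
    have : (0 : ℝ) ≤ k := by positivity
    linarith
  · rw [Finset.prod_Ico_eq_prod_range, ← Finset.prod_range_add_one_eq_factorial, Nat.cast_prod]
    have : m + 1 - (j + 1) = m - j := by omega
    rw [this]
    refine Finset.prod_congr rfl fun k _ => ?_
    push_cast
    rw [abs_sub_comm, abs_of_nonneg] <;> [ring; skip]
    have : (0 : ℝ) ≤ k := by positivity
    linarith

/-- Lagrange interpolation at the nodes j / m. The j-th basis polynomial at t is at most (‖t‖ + 1)^m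
· m^m / (j! (m - j)!), which is (‖t‖ + 1)^m · (m^m / m!) · C(m, j). The bound m^m / m! ≤ e^m and the
sum 2^m of the binomial coefficients give the constant. -/
lemma exists_extrapolation_coeff (m : ℕ) (t : ℂ) :
    ∃ c : ℕ → ℂ, (∑ j ∈ Finset.range (m + 1), ‖c j‖ ≤ (2 * Real.exp 1 * (‖t‖ + 1)) ^ m) ∧
      ∀ f : Polynomial ℂ, f.natDegree ≤ m →
        f.eval t = ∑ j ∈ Finset.range (m + 1), c j * f.eval ((((j : ℝ) / m : ℝ)) : ℂ) := by
  set v : ℕ → ℂ := fun j => (((j : ℝ) / m : ℝ) : ℂ) with hv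
  have hinj : Set.InjOn v (Finset.range (m + 1) : Set ℕ) := by
    -- For m = 0 the single node is 0 / 0 = 0, which is still admissible.
    rcases Nat.eq_zero_or_pos m with rfl | hm
    · intro a ha b hb _
      simp at ha hb; omega
    · intro a _ b _ hab
      have hm' : (m : ℝ) ≠ 0 := by positivity
      simp only [hv, Complex.ofReal_inj] at hab
      rw [div_left_inj' hm'] at hab
      exact_mod_cast hab
  refine ⟨fun j => (Lagrange.basis (Finset.range (m + 1)) v j).eval t, ?_, ?_⟩
  · have key : ∀ j ∈ Finset.range (m + 1), ‖(Lagrange.basis (Finset.range (m + 1)) v j).eval t‖ ≤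
        (‖t‖ + 1) ^ m * ((m : ℝ) ^ m / m.factorial) * (m.choose j : ℝ) := by
      intro j hj
      have hjm : j ≤ m := Nat.lt_succ_iff.1 (Finset.mem_range.1 hj)
      have hcard : ((Finset.range (m + 1)).erase j).card = m := by
        rw [Finset.card_erase_of_mem hj, Finset.card_range]; rfl
      rw [Lagrange.basis, Polynomial.eval_prod, norm_prod]
      calc ∏ k ∈ (Finset.range (m + 1)).erase j, ‖(Lagrange.basisDivisor (v j) (v k)).eval t‖
          ≤ ∏ k ∈ (Finset.range (m + 1)).erase j, ((‖t‖ + 1) * (m * |(j : ℝ) - k|⁻¹)) := by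
            refine Finset.prod_le_prod (fun _ _ => norm_nonneg _) fun k hk => ?_
            have hkm : k ≤ m := by
              have := (Finset.mem_erase.1 hk).2; simp at this; omega
            have hkj : k ≠ j := (Finset.mem_erase.1 hk).1
            have hmpos : 0 < m := by omega
            have hvk : ‖v k‖ ≤ 1 := by
              simp only [hv, Complex.norm_real, Real.norm_eq_abs]
              rw [abs_of_nonneg (by positivity), div_le_one (by positivity)]
              exact_mod_cast hkm
            have hd : ‖(v j - v k)⁻¹‖ = m * |(j : ℝ) - k|⁻¹ := by
              have : v j - v k = ((((j : ℝ) - k) / m : ℝ) : ℂ) := by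
                simp only [hv]; push_cast; ring
              rw [this, norm_inv, Complex.norm_real, Real.norm_eq_abs, abs_div, Nat.abs_cast,
                inv_div, div_eq_mul_inv]
            rw [Lagrange.basisDivisor]
            simp only [Polynomial.eval_mul, Polynomial.eval_C, Polynomial.eval_sub,
              Polynomial.eval_X, norm_mul, hd]
            rw [mul_comm]
            gcongr
            exact (norm_sub_le _ _).trans (by linarith)
        _ = (‖t‖ + 1) ^ m * (m ^ m * ((j.factorial : ℝ) * (m - j).factorial)⁻¹) := by
            rw [Finset.prod_mul_distrib, Finset.prod_mul_distrib, Finset.prod_const,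
              Finset.prod_const, hcard, Finset.prod_inv_distrib, prod_abs_sub_eq_factorial hjm]
        _ = _ := by
            rw [Nat.cast_choose ℝ hjm]
            have : (m.factorial : ℝ) ≠ 0 := by positivity
            field_simp
    refine (Finset.sum_le_sum key).trans ?_
    rw [← Finset.mul_sum]
    have h2 : ∑ j ∈ Finset.range (m + 1), (m.choose j : ℝ) = 2 ^ m := by
      exact_mod_cast Nat.sum_range_choose m
    have h3 : (m : ℝ) ^ m / m.factorial ≤ Real.exp 1 ^ m := by
      rw [← Real.exp_nat_mul, mul_one]
      exact Real.pow_div_factorial_le_exp _ (by positivity) m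
    rw [h2, mul_pow, mul_pow]
    calc (‖t‖ + 1) ^ m * ((m : ℝ) ^ m / m.factorial) * 2 ^ m
        ≤ (‖t‖ + 1) ^ m * (Real.exp 1 ^ m) * 2 ^ m := by gcongr
      _ = _ := by ring
  · intro f hf
    have hdeg : f.degree < ((Finset.range (m + 1)).card : WithBot ℕ) := by
      rw [Finset.card_range]
      exact lt_of_le_of_lt (Polynomial.degree_le_of_natDegree_le hf)
        (by exact_mod_cast m.lt_succ_self)
    have := Lagrange.eq_interpolate hinj hdeg
    conv_lhs => rw [this]
    rw [Lagrange.interpolate_apply, Polynomial.eval_finsetSum]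
    refine Finset.sum_congr rfl fun j _ => ?_
    rw [Polynomial.eval_mul, Polynomial.eval_C, mul_comm]

/-! ### The seminorms `eLpNorm'` on product spaces -/

section eLpNorm'

variable {α β γ E F : Type*} [MeasurableSpace α] [MeasurableSpace β] [MeasurableSpace γ]
  [NormedAddCommGroup E] [NormedAddCommGroup F] {p : ℝ}

lemma eLpNorm'_rpow (hp : 0 < p) (f : α → E) (μ : Measure α) :
    eLpNorm' f p μ ^ p = ∫⁻ x, ‖f x‖ₑ ^ p ∂μ := by
  rw [eLpNorm'_eq_lintegral_enorm, ← ENNReal.rpow_mul, one_div_mul_cancel hp.ne', ENNReal.rpow_one]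

lemma eLpNorm'_comp_measurePreserving {g : α → β} {μ : Measure α} {ν : Measure β}
    (hg : MeasurePreserving g μ ν) {f : β → E} (hf : StronglyMeasurable f) :
    eLpNorm' (fun x => f (g x)) p μ = eLpNorm' f p ν := by
  rw [eLpNorm'_eq_lintegral_enorm, eLpNorm'_eq_lintegral_enorm,
    ← hg.lintegral_comp (f := fun x => ‖f x‖ₑ ^ p) (hf.enorm.pow_const p)]

lemma eLpNorm'_le_mul_iff (hp : 0 < p) {f : α → E} {g : β → F} {μ : Measure α} {ν : Measure β}
    {K : ℝ≥0∞} :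
    eLpNorm' f p μ ≤ K * eLpNorm' g p ν ↔
      ∫⁻ x, ‖f x‖ₑ ^ p ∂μ ≤ K ^ p * ∫⁻ x, ‖g x‖ₑ ^ p ∂ν := by
  rw [← ENNReal.rpow_le_rpow_iff hp, ENNReal.mul_rpow_of_nonneg _ _ hp.le, eLpNorm'_rpow hp,
    eLpNorm'_rpow hp]

/-- Conditioning: an inequality valid for almost every frozen value of one variable, with a uniform
constant, integrates by Tonelli. Infinite norms are allowed on both sides. -/
lemma eLpNorm'_prod_le_of_ae_section_le (hp : 0 < p) {μ : Measure α} {ν : Measure β}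
    {ν' : Measure γ} [SFinite μ] [SFinite ν] [SFinite ν'] {f : α × β → E} {g : α × γ → F}
    (hf : StronglyMeasurable f) (hg : StronglyMeasurable g) {K : ℝ≥0∞} (hK : K ≠ ∞)
    (h : ∀ᵐ x ∂μ, eLpNorm' (fun y => f (x, y)) p ν ≤ K * eLpNorm' (fun y => g (x, y)) p ν') :
    eLpNorm' f p (μ.prod ν) ≤ K * eLpNorm' g p (μ.prod ν') := by
  rw [eLpNorm'_le_mul_iff hp, lintegral_prod _ (hf.enorm.pow_const p).aemeasurable,
    lintegral_prod _ (hg.enorm.pow_const p).aemeasurable,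
    ← lintegral_const_mul' _ _ (ENNReal.rpow_ne_top_of_nonneg hp.le hK)]
  refine lintegral_mono_ae ?_
  filter_upwards [h] with x hx
  exact (eLpNorm'_le_mul_iff hp).1 hx

lemma eLpNorm'_prod_swap {μ : Measure α} {ν : Measure β} [SFinite μ] [SFinite ν] {f : α × β → E}
    (hf : StronglyMeasurable f) :
    eLpNorm' (fun x : β × α => f x.swap) p (ν.prod μ) = eLpNorm' f p (μ.prod ν) :=
  eLpNorm'_comp_measurePreserving Measure.measurePreserving_swap hf

lemma eLpNorm'_prod_snd {μ : Measure α} {ν : Measure β} [IsProbabilityMeasure μ] [SFinite ν]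
    {f : β → E} (hf : StronglyMeasurable f) :
    eLpNorm' (fun x : α × β => f x.2) p (μ.prod ν) = eLpNorm' f p ν :=
  eLpNorm'_comp_measurePreserving measurePreserving_snd hf

lemma eLpNorm'_prod_fst {μ : Measure α} {ν : Measure β} [IsProbabilityMeasure ν] [SFinite μ]
    {f : α → E} (hf : StronglyMeasurable f) :
    eLpNorm' (fun x : α × β => f x.1) p (μ.prod ν) = eLpNorm' f p μ :=
  eLpNorm'_comp_measurePreserving measurePreserving_fst hf

lemma enorm_integral_le_eLpNorm' [NormedSpace ℝ E] (hp : 1 ≤ p) {μ : Measure α}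
    [IsProbabilityMeasure μ] {f : α → E} (hf : StronglyMeasurable f) :
    ‖∫ x, f x ∂μ‖ₑ ≤ eLpNorm' f p μ := by
  refine (enorm_integral_le_lintegral_enorm f).trans ?_
  have := eLpNorm'_le_eLpNorm'_of_exponent_le zero_lt_one hp (μ := μ) hf.aestronglyMeasurable
  simpa [eLpNorm'_eq_lintegral_enorm] using this

/-- A linear combination of functions of seminorm at most `M`. -/
lemma eLpNorm'_sum_smul_le [NormedSpace ℂ E] (hp : 1 ≤ p) {ι : Type*} (s : Finset ι) (c : ι → ℂ)
    {f : ι → α → E} {μ : Measure α} (hf : ∀ i ∈ s, AEStronglyMeasurable (f i) μ) {M : ℝ≥0∞}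
    (hM : ∀ i ∈ s, eLpNorm' (f i) p μ ≤ M) :
    eLpNorm' (fun x => ∑ i ∈ s, c i • f i x) p μ ≤ (∑ i ∈ s, ‖c i‖ₑ) * M := by
  have h0 : (fun x => ∑ i ∈ s, c i • f i x) = ∑ i ∈ s, c i • f i := by
    ext x; simp
  rw [h0]
  refine (eLpNorm'_sum_le (fun i hi => (hf i hi).const_smul (c i)) hp).trans ?_
  rw [Finset.sum_mul]
  refine Finset.sum_le_sum fun i hi => ?_
  refine (eLpNorm'_const_smul_le (zero_lt_one.trans_le hp)).trans ?_
  gcongr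
  exact hM i hi

lemma eLpNorm'_prod_le_of_ae_section_le_left (hp : 0 < p) {μ : Measure α} {ν : Measure β}
    [SFinite μ] [SFinite ν] {f : α × β → E} {g : α × β → F}
    (hf : StronglyMeasurable f) (hg : StronglyMeasurable g) {K : ℝ≥0∞} (hK : K ≠ ∞)
    (h : ∀ᵐ y ∂ν, eLpNorm' (fun x => f (x, y)) p μ ≤ K * eLpNorm' (fun x => g (x, y)) p μ) :
    eLpNorm' f p (μ.prod ν) ≤ K * eLpNorm' g p (μ.prod ν) := by
  rw [← eLpNorm'_prod_swap hf, ← eLpNorm'_prod_swap hg]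
  exact eLpNorm'_prod_le_of_ae_section_le hp (hf.comp_measurable measurable_swap)
    (hg.comp_measurable measurable_swap) hK h

lemma eLpNorm'_le_prod_of_enorm_le_section (hp : 0 < p) {μ : Measure α} {ν : Measure β}
    [SFinite μ] [IsProbabilityMeasure ν] {f : α → E} {g : α × β → F}
    (hf : StronglyMeasurable f) (hg : StronglyMeasurable g) {K : ℝ≥0∞} (hK : K ≠ ∞)
    (h : ∀ x, ‖f x‖ₑ ≤ K * eLpNorm' (fun y => g (x, y)) p ν) :
    eLpNorm' f p μ ≤ K * eLpNorm' g p (μ.prod ν) := by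
  rw [← eLpNorm'_prod_fst (ν := ν) hf]
  refine eLpNorm'_prod_le_of_ae_section_le hp (hf.comp_measurable measurable_fst) hg hK
    (Filter.Eventually.of_forall fun x => ?_)
  change eLpNorm' (fun _ => f x) p ν ≤ _
  rw [eLpNorm'_const_of_isProbabilityMeasure _ hp]
  exact h x

end eLpNorm'

section Contraction

/-! ### Contraction principles for tetrahedral polynomials -/

namespace TetrahedralPolynomial

variable {n : ℕ} {X : Type*} [NormedAddCommGroup X] [NormedSpace ℂ X]

lemma continuous_eval (P : TetrahedralPolynomial n X) : Continuous P.eval := by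
  unfold eval
  fun_prop

lemma stronglyMeasurable_eval (P : TetrahedralPolynomial n X) : StronglyMeasurable P.eval :=
  P.continuous_eval.stronglyMeasurable

lemma card_le_degree {X : Type*} [NormedAddCommGroup X] (P : TetrahedralPolynomial n X)
    {A : Finset (Fin n)} (hA : P A ≠ 0) : A.card ≤ P.degree := by
  classical
  exact Finset.le_sup (f := Finset.card) (by simpa using hA)

/-- The polynomial `u ↦ P(z u)`, with coordinatewise product. -/
def scale (z : Fin n → ℂ) (P : TetrahedralPolynomial n X) : TetrahedralPolynomial n X :=
  fun A => (∏ k ∈ A, z k) • P A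

lemma eval_scale (z : Fin n → ℂ) (P : TetrahedralPolynomial n X) (u : Fin n → ℂ) :
    (P.scale z).eval u = P.eval (z * u) := by
  unfold eval scale
  refine Finset.sum_congr rfl fun A _ => ?_
  simp only [Pi.mul_apply, Finset.prod_mul_distrib, smul_smul, mul_comm]

lemma scale_ne_zero {z : Fin n → ℂ} {P : TetrahedralPolynomial n X} {A : Finset (Fin n)}
    (h : P.scale z A ≠ 0) : P A ≠ 0 := by
  intro h0; exact h (by simp [scale, h0])

/-- If, on every monomial of `P`, the value at `z` is a linear combination of the values at
`y j`, then the same holds for `P(z u)`. -/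
lemma eval_mul_eq_sum {ι : Type*} (P : TetrahedralPolynomial n X) (s : Finset ι) (c : ι → ℂ)
    (y : ι → Fin n → ℂ) (z : Fin n → ℂ)
    (h : ∀ A, P A ≠ 0 → ∏ k ∈ A, z k = ∑ j ∈ s, c j * ∏ k ∈ A, y j k) (u : Fin n → ℂ) :
    P.eval (z * u) = ∑ j ∈ s, c j • P.eval (y j * u) := by
  simp only [eval, Finset.smul_sum]
  rw [Finset.sum_comm]
  refine Finset.sum_congr rfl fun A _ => ?_
  by_cases hA : P A = 0
  · simp [hA]
  · simp only [Pi.mul_apply, Finset.prod_mul_distrib, h A hA, smul_smul, ← Finset.sum_smul,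
      Finset.sum_mul, mul_assoc]

end TetrahedralPolynomial

variable {n : ℕ} {X : Type*} [NormedAddCommGroup X] [NormedSpace ℂ X] {p : ℝ}

/-- A law on `ℂ` that is invariant under `z ↦ -z`. -/
def IsSymmetricLaw (ν : Measure ℂ) : Prop := MeasurePreserving (fun z : ℂ => -z) ν ν

lemma stronglyMeasurable_eval_mul (P : TetrahedralPolynomial n X) (z : Fin n → ℂ) :
    StronglyMeasurable fun u => P.eval (z * u) :=
  (P.continuous_eval.comp (continuous_const.mul continuous_id)).stronglyMeasurable

lemma measurePreserving_sign_mul {ν : Measure ℂ} [IsProbabilityMeasure ν] (hν : IsSymmetricLaw ν)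
    (σ : Fin n → ℤˣ) :
    MeasurePreserving (fun (u : Fin n → ℂ) i => ((σ i : ℤ) : ℂ) * u i)
      (Measure.pi fun _ => ν) (Measure.pi fun _ => ν) := by
  refine measurePreserving_pi (fun _ : Fin n => ν) (fun _ : Fin n => ν)
    (f := fun i u => ((σ i : ℤ) : ℂ) * u) fun i => ?_
  rcases Int.units_eq_one_or (σ i) with h | h
  · simpa [h] using! MeasurePreserving.id ν
  · simpa [h, IsSymmetricLaw] using hν

lemma eLpNorm'_eval_sign_mul {ν : Measure ℂ} [IsProbabilityMeasure ν] (hν : IsSymmetricLaw ν)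
    (P : TetrahedralPolynomial n X) (σ : Fin n → ℤˣ) :
    eLpNorm' (fun u => P.eval ((fun i => ((σ i : ℤ) : ℂ)) * u)) p (Measure.pi fun _ => ν) =
      eLpNorm' P.eval p (Measure.pi fun _ => ν) :=
  eLpNorm'_comp_measurePreserving (measurePreserving_sign_mul hν σ) P.stronglyMeasurable_eval

lemma sum_units_int {M : Type*} [AddCommMonoid M] (f : ℤˣ → M) : ∑ σ, f σ = f 1 + f (-1) := by
  rw [show (Finset.univ : Finset ℤˣ) = {1, -1} from rfl, Finset.sum_pair (by decide)]

/-- For real rᵢ in [-1, 1] the weights are the probabilities of independent signs with means rᵢ, and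
the formula says that the mean of a product of distinct signs is the product of the means. -/
lemma prod_eq_sum_signs (r : Fin n → ℂ) (A : Finset (Fin n)) :
    ∏ k ∈ A, r k = ∑ σ : Fin n → ℤˣ, (∏ i, (1 + (σ i : ℤ) * r i) / 2) *
      ∏ k ∈ A, (((σ k : ℤ) : ℂ)) := by
  have h : ∀ σ : Fin n → ℤˣ, (∏ i, (1 + (σ i : ℤ) * r i) / 2) * ∏ k ∈ A, (((σ k : ℤ) : ℂ)) =
      ∏ i, ((1 + (σ i : ℤ) * r i) / 2 * if i ∈ A then ((σ i : ℤ) : ℂ) else 1) := by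
    intro σ
    rw [Finset.prod_mul_distrib, Finset.prod_ite_mem, Finset.univ_inter]
  simp_rw [h]
  rw [← Fintype.prod_sum (fun i (s : ℤˣ) =>
      (1 + ((s : ℤ) : ℂ) * r i) / 2 * if i ∈ A then ((s : ℤ) : ℂ) else 1)]
  have : ∀ i, ∑ s : ℤˣ, ((1 + ((s : ℤ) : ℂ) * r i) / 2 * if i ∈ A then ((s : ℤ) : ℂ) else 1) =
      if i ∈ A then r i else 1 := by
    intro i
    rw [sum_units_int]
    split_ifs <;> simp <;> ring
  simp_rw [this]
  rw [Finset.prod_ite_mem, Finset.univ_inter]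

/-- The contraction principle for real multipliers. -/
lemma eLpNorm'_eval_real_mul_le (hp : 1 ≤ p) {ν : Measure ℂ} [IsProbabilityMeasure ν]
    (hν : IsSymmetricLaw ν) (P : TetrahedralPolynomial n X) {r : Fin n → ℝ} (hr : ∀ i, |r i| ≤ 1) :
    eLpNorm' (fun u => P.eval ((fun i => (r i : ℂ)) * u)) p (Measure.pi fun _ => ν) ≤
      eLpNorm' P.eval p (Measure.pi fun _ => ν) := by
  set c : (Fin n → ℤˣ) → ℝ := fun σ => ∏ i, (1 + (σ i : ℤ) * r i) / 2 with hc
  have hc0 : ∀ σ, 0 ≤ c σ := by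
    intro σ
    refine Finset.prod_nonneg fun i _ => ?_
    have := abs_le.1 (hr i)
    rcases Int.units_eq_one_or (σ i) with h | h <;> simp [h] <;> linarith
  have hc1 : ∑ σ, c σ = 1 := by
    simp only [hc]
    rw [← Fintype.prod_sum (fun i (s : ℤˣ) => (1 + ((s : ℤ) : ℝ) * r i) / 2)]
    refine Finset.prod_eq_one fun i _ => ?_
    rw [sum_units_int]; simp; ring
  have h := fun u => P.eval_mul_eq_sum Finset.univ (fun σ => (c σ : ℂ))
    (fun σ i => ((σ i : ℤ) : ℂ)) (fun i => (r i : ℂ))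
    (fun A _ => by rw [prod_eq_sum_signs]; simp [hc]) u
  simp_rw [h]
  refine (eLpNorm'_sum_smul_le hp Finset.univ _
    (fun σ _ => (stronglyMeasurable_eval_mul P _).aestronglyMeasurable)
    (fun σ _ => (eLpNorm'_eval_sign_mul hν P σ).le)).trans ?_
  have h2 : ∑ σ, ‖(c σ : ℂ)‖ₑ = 1 := by
    have : ∀ σ, ‖(c σ : ℂ)‖ₑ = ENNReal.ofReal (c σ) := fun σ => by
      rw [← ofReal_norm, Complex.norm_real, Real.norm_of_nonneg (hc0 σ)]
    simp_rw [this]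
    rw [← ENNReal.ofReal_sum_of_nonneg fun σ _ => hc0 σ, hc1, ENNReal.ofReal_one]
  rw [h2, one_mul]

/-- The extrapolation constant. -/
def extraConst (R : ℝ) : ℝ≥0 := Real.toNNReal (2 * Real.exp 1 * (R + 1))

lemma one_le_extraConst {R : ℝ} (hR : 0 ≤ R) : 1 ≤ extraConst R := by
  rw [extraConst, ← Real.toNNReal_one]
  apply Real.toNNReal_le_toNNReal
  have := Real.add_one_le_exp 1
  nlinarith

lemma sum_enorm_le_extraConst_pow {m : ℕ} {t : ℂ} {c : ℕ → ℂ}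
    (h : ∑ j ∈ Finset.range (m + 1), ‖c j‖ ≤ (2 * Real.exp 1 * (‖t‖ + 1)) ^ m) :
    ∑ j ∈ Finset.range (m + 1), ‖c j‖ₑ ≤ (extraConst ‖t‖ : ℝ≥0∞) ^ m := by
  have : ∀ j, ‖c j‖ₑ = ENNReal.ofReal ‖c j‖ := fun j => (ofReal_norm _).symm
  simp_rw [this]
  rw [← ENNReal.ofReal_sum_of_nonneg fun j _ => norm_nonneg _, extraConst,
    ← ENNReal.ofReal, ← ENNReal.ofReal_pow (by positivity)]
  exact ENNReal.ofReal_le_ofReal h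

/-- Extrapolation along a complex line of multipliers, from the segment `[0, 1]`. -/
lemma eLpNorm'_eval_line_le (hp : 1 ≤ p) {μ : Measure (Fin n → ℂ)}
    (P : TetrahedralPolynomial n X) {m : ℕ} (hP : ∀ A, P A ≠ 0 → A.card ≤ m) (a b : Fin n → ℂ)
    {M : ℝ≥0∞} (hM : ∀ t : ℝ, 0 ≤ t → t ≤ 1 →
      eLpNorm' (fun u => P.eval ((fun i => a i + t * b i) * u)) p μ ≤ M) (t : ℂ) :
    eLpNorm' (fun u => P.eval ((fun i => a i + t * b i) * u)) p μ ≤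
      (extraConst ‖t‖ : ℝ≥0∞) ^ m * M := by
  obtain ⟨c, hc, hint⟩ := exists_extrapolation_coeff m t
  have h := fun u => P.eval_mul_eq_sum (Finset.range (m + 1)) c
    (fun j i => a i + (((j : ℝ) / m : ℝ) : ℂ) * b i) (fun i => a i + t * b i)
    (fun A hA => by
      -- Along the line, each monomial is a polynomial in t with one factor of degree at most 1 for
      -- each element of A.
      have := hint (∏ k ∈ A, (Polynomial.C (a k) + Polynomial.X * Polynomial.C (b k))) (by
        refine (Polynomial.natDegree_prod_le _ _).trans ((Finset.sum_le_card_nsmul _ _ 1 ?_).trans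
          (by simpa using hP A hA))
        intro k _
        compute_degree)
      simpa [Polynomial.eval_prod, mul_comm (b _)] using this) u
  simp_rw [h]
  refine (eLpNorm'_sum_smul_le hp (Finset.range (m + 1)) c
    (fun j _ => (stronglyMeasurable_eval_mul P _).aestronglyMeasurable)
    (fun j hj => hM ((j : ℝ) / m) (by positivity) ?_)).trans ?_
  · exact div_le_one_of_le₀ (by exact_mod_cast Nat.lt_succ_iff.1 (Finset.mem_range.1 hj))
      (by positivity)
  · gcongr
    exact sum_enorm_le_extraConst_pow hc

/-- The constant in the contraction principle for complex multipliers of modulus at most `R`. -/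
def contrConst (R : ℝ) : ℝ≥0 := extraConst 1 * extraConst (2 * R)

lemma one_le_contrConst {R : ℝ} (hR : 0 ≤ R) : 1 ≤ contrConst R :=
  one_le_mul (one_le_extraConst zero_le_one) (one_le_extraConst (by positivity))

/-- The multipliers Re z + t Im z are real and bounded by 1 for t in [0, 1], thanks to the radius
1/2; extrapolation to t = i recovers z. -/
lemma eLpNorm'_eval_half_mul_le (hp : 1 ≤ p) {ν : Measure ℂ} [IsProbabilityMeasure ν]
    (hν : IsSymmetricLaw ν) (P : TetrahedralPolynomial n X) {m : ℕ}
    (hP : ∀ A, P A ≠ 0 → A.card ≤ m) {z : Fin n → ℂ} (hz : ∀ i, ‖z i‖ ≤ 1 / 2) :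
    eLpNorm' (fun u => P.eval (z * u)) p (Measure.pi fun _ => ν) ≤
      (extraConst 1 : ℝ≥0∞) ^ m * eLpNorm' P.eval p (Measure.pi fun _ => ν) := by
  have h := eLpNorm'_eval_line_le hp (μ := Measure.pi fun _ => ν) P hP
    (fun i => ((z i).re : ℂ)) (fun i => ((z i).im : ℂ))
    (M := eLpNorm' P.eval p (Measure.pi fun _ => ν)) (fun t ht0 ht1 => by
      have := eLpNorm'_eval_real_mul_le hp hν P (r := fun i => (z i).re + t * (z i).im) (fun i => by
        have h1 := (Complex.abs_re_le_norm (z i)).trans (hz i)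
        have h2 := (Complex.abs_im_le_norm (z i)).trans (hz i)
        refine (abs_add_le _ _).trans ?_
        rw [abs_mul, abs_of_nonneg ht0]
        nlinarith [abs_nonneg (z i).im])
      simpa using this) Complex.I
  simp only [Complex.norm_I] at h
  convert h using 4
  ext i
  simp only [Pi.mul_apply]
  rw [mul_comm Complex.I, Complex.re_add_im]

/-- The contraction principle for complex multipliers. -/
lemma eLpNorm'_eval_mul_le (hp : 1 ≤ p) {ν : Measure ℂ} [IsProbabilityMeasure ν]
    (hν : IsSymmetricLaw ν) (P : TetrahedralPolynomial n X) {m : ℕ}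
    (hP : ∀ A, P A ≠ 0 → A.card ≤ m) {R : ℝ} (hR : 0 < R) {z : Fin n → ℂ} (hz : ∀ i, ‖z i‖ ≤ R) :
    eLpNorm' (fun u => P.eval (z * u)) p (Measure.pi fun _ => ν) ≤
      (contrConst R : ℝ≥0∞) ^ m * eLpNorm' P.eval p (Measure.pi fun _ => ν) := by
  -- The multipliers t z / (2R) lie in the disc of radius 1/2 for t in [0, 1], and t = 2R gives z.
  have h := eLpNorm'_eval_line_le hp (μ := Measure.pi fun _ => ν) P hP
    0 (fun i => z i / (2 * R))
    (M := (extraConst 1 : ℝ≥0∞) ^ m * eLpNorm' P.eval p (Measure.pi fun _ => ν))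
    (fun t ht0 ht1 => by
      refine eLpNorm'_eval_half_mul_le hp hν P hP fun i => ?_
      simp only [Pi.zero_apply, zero_add, norm_mul, norm_div, Complex.norm_real, Complex.norm_ofNat,
        Real.norm_of_nonneg ht0, Real.norm_of_nonneg hR.le]
      have : ‖z i‖ / (2 * R) ≤ 1 / 2 := by
        rw [div_le_div_iff₀ (by positivity) (by positivity)]; linarith [hz i]
      have h0 : 0 ≤ ‖z i‖ / (2 * R) := by positivity
      nlinarith) ((2 * R : ℝ) : ℂ)
  rw [Complex.norm_real, Real.norm_of_nonneg (by positivity), ← mul_assoc, ← mul_pow] at h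
  have e : (fun i => (0 : Fin n → ℂ) i + ((2 * R : ℝ) : ℂ) * (z i / (2 * R))) = z := by
    ext i
    have : (R : ℂ) ≠ 0 := by exact_mod_cast hR.ne'
    simp; field_simp
  rw [e] at h
  rwa [contrConst, ENNReal.coe_mul, mul_comm (extraConst 1 : ℝ≥0∞)]

/-- Comparison of `P(z u)` and `P(y u)` when `|z| ≤ R |y|` coordinatewise. -/
lemma eLpNorm'_eval_mul_le_of_norm_le (hp : 1 ≤ p) {ν : Measure ℂ} [IsProbabilityMeasure ν]
    (hν : IsSymmetricLaw ν) (P : TetrahedralPolynomial n X) {m : ℕ}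
    (hP : ∀ A, P A ≠ 0 → A.card ≤ m) {R : ℝ} (hR : 0 < R) {z y : Fin n → ℂ}
    (hz : ∀ i, ‖z i‖ ≤ R * ‖y i‖) :
    eLpNorm' (fun u => P.eval (z * u)) p (Measure.pi fun _ => ν) ≤
      (contrConst R : ℝ≥0∞) ^ m * eLpNorm' (fun u => P.eval (y * u)) p (Measure.pi fun _ => ν) := by
  -- The multiplier is z / y; division by zero is harmless, since yᵢ = 0 forces zᵢ = 0.
  have h := eLpNorm'_eval_mul_le hp hν (P.scale y) (m := m) (fun A hA => hP A (scale_ne_zero hA))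
    hR (z := z / y) (fun i => by
      rw [Pi.div_apply, norm_div]
      exact div_le_of_le_mul₀ (norm_nonneg _) hR.le (hz i))
  have e : (P.scale y).eval = fun u => P.eval (y * u) := funext fun u => eval_scale _ _ _
  have e' : y * (z / y) = z := by
    ext i
    by_cases hy : y i = 0
    · have : z i = 0 := by simpa [hy] using hz i
      simp [hy, this]
    · simp; field_simp
  rw [e] at h
  simp only [← mul_assoc, e'] at h
  exact h

end Contraction

section LowerEstimate

/-! ### Laws on the unit circle -/

/-- A law on `ℂ` that is concentrated on the unit circle. -/
def IsUnimodularLaw (ν : Measure ℂ) : Prop := ∀ᵐ z ∂ν, ‖z‖ = 1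

lemma ae_pi_of_ae {ι : Type*} [Fintype ι] {ν : Measure ℂ} [IsProbabilityMeasure ν] {q : ℂ → Prop}
    (h : ∀ᵐ z ∂ν, q z) : ∀ᵐ u ∂(Measure.pi fun _ : ι => ν), ∀ i, q (u i) := by
  rw [ae_all_iff]
  intro i
  exact (measurePreserving_eval (fun _ : ι => ν) i).quasiMeasurePreserving.ae h

/-- On the additive circle, the symmetry z ↦ -z becomes translation by 1/2, which preserves Haar
measure. -/
lemma steinhausLaw_eq_map_toCircle :
    steinhausLaw = (volume : Measure UnitAddCircle).map fun x => (AddCircle.toCircle x : ℂ) := by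
  have hm : Measurable fun x : UnitAddCircle => (AddCircle.toCircle x : ℂ) :=
    (continuous_subtype_val.comp AddCircle.continuous_toCircle).measurable
  have h := UnitAddCircle.measurePreserving_mk 0
  rw [steinhausLaw, ← h.map_eq, Measure.map_map hm h.measurable, zero_add,
    restrict_Ioc_eq_restrict_Icc]
  congr 1
  ext t
  simp only [Function.comp_apply, AddCircle.toCircle_apply_mk, Circle.coe_exp]
  push_cast
  congr 1
  ring

instance : IsProbabilityMeasure steinhausLaw := by
  rw [steinhausLaw_eq_map_toCircle]
  have : IsProbabilityMeasure (volume : Measure UnitAddCircle) := ⟨UnitAddCircle.measure_univ⟩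
  exact Measure.isProbabilityMeasure_map
    (continuous_subtype_val.comp AddCircle.continuous_toCircle).measurable.aemeasurable

lemma isUnimodularLaw_steinhausLaw : IsUnimodularLaw steinhausLaw := by
  have hm : Measurable fun x : UnitAddCircle => (AddCircle.toCircle x : ℂ) :=
    (continuous_subtype_val.comp AddCircle.continuous_toCircle).measurable
  rw [IsUnimodularLaw, steinhausLaw_eq_map_toCircle, ae_map_iff hm.aemeasurable
    (measurableSet_eq_fun measurable_norm measurable_const)]
  exact Filter.Eventually.of_forall fun x => Circle.norm_coe _

lemma isSymmetricLaw_steinhausLaw : IsSymmetricLaw steinhausLaw := by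
  have hm : Measurable fun x : UnitAddCircle => (AddCircle.toCircle x : ℂ) :=
    (continuous_subtype_val.comp AddCircle.continuous_toCircle).measurable
  refine ⟨measurable_neg, ?_⟩
  rw [steinhausLaw_eq_map_toCircle, Measure.map_map measurable_neg hm]
  have h := measurePreserving_add_right (volume : Measure UnitAddCircle)
    ((1 / 2 : ℝ) : UnitAddCircle)
  conv_rhs => rw [← h.map_eq, Measure.map_map hm h.measurable]
  congr 1
  ext x
  have h1 : ((AddCircle.toCircle ((1 / 2 : ℝ) : UnitAddCircle) : Circle) : ℂ) = -1 := by
    rw [AddCircle.toCircle_apply_mk, Circle.coe_exp]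
    rw [← Complex.exp_pi_mul_I]
    push_cast
    congr 1
    ring
  simp only [Function.comp_apply, AddCircle.toCircle_add, Circle.coe_mul, h1]
  ring

/-! ### The lower estimate -/

variable {n : ℕ} {X : Type*} [NormedAddCommGroup X] [NormedSpace ℂ X] {p : ℝ}

/-- No variable is repeated in a monomial, so independence factors the mean of each monomial. -/
lemma integral_eval_mul [CompleteSpace X] {ν : Measure ℂ} [IsProbabilityMeasure ν] {η : ℂ → ℝ}
    (hη : Measurable η) (hη1 : ∀ z, |η z| ≤ 1) (P : TetrahedralPolynomial n X) (w : Fin n → ℂ) :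
    ∫ z, P.eval ((fun i => (η (z i) : ℂ)) * w) ∂(Measure.pi fun _ : Fin n => ν) =
      P.eval ((fun _ => ((∫ z, η z ∂ν : ℝ) : ℂ)) * w) := by
  have hint : ∀ A : Finset (Fin n), Integrable
      (fun z : Fin n → ℂ => ∏ k ∈ A, (η (z k) : ℂ)) (Measure.pi fun _ : Fin n => ν) := by
    intro A
    refine Integrable.of_bound (C := 1) (Measurable.aestronglyMeasurable ?_)
      (Filter.Eventually.of_forall fun z => ?_)
    · exact Finset.measurable_prod _ fun k _ =>
        Complex.measurable_ofReal.comp (hη.comp (measurable_pi_apply k))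
    · rw [norm_prod]
      exact Finset.prod_le_one (fun _ _ => norm_nonneg _) fun k _ => by simpa using hη1 _
  simp only [eval, Pi.mul_apply, Finset.prod_mul_distrib]
  rw [integral_finsetSum]
  · refine Finset.sum_congr rfl fun A _ => ?_
    rw [integral_smul_const, integral_mul_const]
    congr 2
    have h1 : ∀ z : Fin n → ℂ, ∏ k ∈ A, (η (z k) : ℂ) =
        ∏ k, (fun z : ℂ => if k ∈ A then (η z : ℂ) else 1) (z k) := by
      intro z; rw [Finset.prod_ite_mem, Finset.univ_inter]
    simp_rw [h1]
    rw [integral_fintype_prod_eq_prod (μ := fun _ : Fin n => ν)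
      (fun k (z : ℂ) => if k ∈ A then (η z : ℂ) else 1)]
    have h2 : ∀ k, ∫ z, (if k ∈ A then (η z : ℂ) else 1) ∂ν =
        if k ∈ A then ((∫ z, η z ∂ν : ℝ) : ℂ) else 1 := by
      intro k
      split_ifs
      · exact integral_ofReal
      · simp
    simp_rw [h2]
    rw [Finset.prod_ite_mem, Finset.univ_inter]
  · intro A _
    exact ((hint A).mul_const _).smul_const _

/-- Comparison of a unimodular law with an arbitrary symmetric one. -/
lemma eLpNorm'_eval_unimodular_le [CompleteSpace X] (hp : 1 ≤ p) {ν ρ : Measure ℂ}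
    [IsProbabilityMeasure ν] [IsProbabilityMeasure ρ] (hν : IsSymmetricLaw ν)
    (hρ : IsSymmetricLaw ρ) (hρ1 : IsUnimodularLaw ρ) {δ : ℝ} (hδ : 0 < δ)
    (hδν : ∫ z, min ‖z‖ 1 ∂ν = δ) (P : TetrahedralPolynomial n X) {m : ℕ}
    (hP : ∀ A, P A ≠ 0 → A.card ≤ m) :
    eLpNorm' P.eval p (Measure.pi fun _ => ρ) ≤
      ((contrConst (1 / δ) * contrConst 1 * contrConst 1 : ℝ≥0) : ℝ≥0∞) ^ m *
        eLpNorm' P.eval p (Measure.pi fun _ => ν) := by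
  have hp0 : 0 < p := zero_lt_one.trans_le hp
  have hη : Measurable fun z : ℂ => min ‖z‖ 1 := measurable_norm.min measurable_const
  have hm1 : StronglyMeasurable fun x : (Fin n → ℂ) × (Fin n → ℂ) =>
      P.eval ((fun i => ((min ‖x.2 i‖ 1 : ℝ) : ℂ)) * x.1) := by
    refine P.stronglyMeasurable_eval.comp_measurable
      (measurable_pi_lambda _ fun i => Measurable.mul ?_ (by fun_prop))
    exact Complex.measurable_ofReal.comp (hη.comp (by fun_prop))
  have hm2 : StronglyMeasurable fun x : (Fin n → ℂ) × (Fin n → ℂ) => P.eval (x.2 * x.1) :=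
    P.stronglyMeasurable_eval.comp_measurable (by fun_prop)
  have hm3 : StronglyMeasurable fun x : (Fin n → ℂ) × (Fin n → ℂ) => P.eval x.2 :=
    P.stronglyMeasurable_eval.comp_measurable (by fun_prop)
  -- Contraction with the constant multiplier δ.
  have s1 : eLpNorm' P.eval p (Measure.pi fun _ => ρ) ≤ (contrConst (1 / δ) : ℝ≥0∞) ^ m *
      eLpNorm' (fun w => P.eval ((fun _ => (δ : ℂ)) * w)) p (Measure.pi fun _ => ρ) := by
    have := eLpNorm'_eval_mul_le_of_norm_le hp hρ P hP (R := 1 / δ) (by positivity)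
      (z := 1) (y := fun _ => (δ : ℂ)) (fun i => by
        simp [abs_of_pos hδ, hδ.ne'])
    simpa only [one_mul] using this
  -- For fixed w, the value P(δ w) is a mean over the second variable, and Jensen's inequality
  -- applies.
  have s2 : eLpNorm' (fun w => P.eval ((fun _ => (δ : ℂ)) * w)) p (Measure.pi fun _ => ρ) ≤
      1 * eLpNorm' (fun x : (Fin n → ℂ) × (Fin n → ℂ) =>
        P.eval ((fun i => ((min ‖x.2 i‖ 1 : ℝ) : ℂ)) * x.1)) p
        ((Measure.pi fun _ => ρ).prod (Measure.pi fun _ => ν)) := by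
    refine eLpNorm'_le_prod_of_enorm_le_section hp0 (stronglyMeasurable_eval_mul P _) hm1
      ENNReal.one_ne_top fun w => ?_
    have e := integral_eval_mul (ν := ν) hη (fun z => by
      rw [abs_of_nonneg (by positivity)]; exact min_le_right _ _) P w
    have hm : StronglyMeasurable fun z : Fin n → ℂ =>
        P.eval ((fun i => ((min ‖z i‖ 1 : ℝ) : ℂ)) * w) := by
      refine P.stronglyMeasurable_eval.comp_measurable
        (measurable_pi_lambda _ fun i => Measurable.mul_const ?_ _)
      exact Complex.measurable_ofReal.comp (hη.comp (measurable_pi_apply i))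
    rw [hδν] at e
    rw [one_mul, ← e]
    exact enorm_integral_le_eLpNorm' hp hm
  -- Contraction in w with z frozen, as min(|zᵢ|, 1) ≤ |zᵢ|.
  have s3 : eLpNorm' (fun x : (Fin n → ℂ) × (Fin n → ℂ) =>
        P.eval ((fun i => ((min ‖x.2 i‖ 1 : ℝ) : ℂ)) * x.1)) p
        ((Measure.pi fun _ => ρ).prod (Measure.pi fun _ => ν)) ≤ (contrConst 1 : ℝ≥0∞) ^ m *
      eLpNorm' (fun x : (Fin n → ℂ) × (Fin n → ℂ) => P.eval (x.2 * x.1)) p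
        ((Measure.pi fun _ => ρ).prod (Measure.pi fun _ => ν)) := by
    refine eLpNorm'_prod_le_of_ae_section_le_left hp0 hm1 hm2 (by finiteness)
      (Filter.Eventually.of_forall fun z => ?_)
    refine eLpNorm'_eval_mul_le_of_norm_le hp hρ P hP zero_lt_one
      (z := fun i => ((min ‖z i‖ 1 : ℝ) : ℂ)) (y := z) fun i => ?_
    rw [one_mul, Complex.norm_real, Real.norm_of_nonneg (by positivity)]
    exact min_le_left _ _
  -- Contraction in z with w frozen, as |wᵢ| = 1.
  have s4 : eLpNorm' (fun x : (Fin n → ℂ) × (Fin n → ℂ) => P.eval (x.2 * x.1)) p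
        ((Measure.pi fun _ => ρ).prod (Measure.pi fun _ => ν)) ≤ (contrConst 1 : ℝ≥0∞) ^ m *
      eLpNorm' (fun x : (Fin n → ℂ) × (Fin n → ℂ) => P.eval x.2) p
        ((Measure.pi fun _ => ρ).prod (Measure.pi fun _ => ν)) := by
    refine eLpNorm'_prod_le_of_ae_section_le hp0 hm2 hm3 (by finiteness) ?_
    filter_upwards [ae_pi_of_ae hρ1] with w hw
    have := eLpNorm'_eval_mul_le hp hν P hP zero_lt_one (z := w) fun i => (hw i).le
    simpa only [mul_comm w] using this
  rw [eLpNorm'_prod_snd P.stronglyMeasurable_eval] at s4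
  rw [one_mul] at s2
  push_cast
  rw [mul_pow, mul_pow, mul_assoc, mul_assoc]
  refine s1.trans (mul_le_mul_right (s2.trans (s3.trans (mul_le_mul_right s4 _))) _)

lemma integral_min_norm_one_pos {ν : Measure ℂ} [IsProbabilityMeasure ν] (h : ¬ ∀ᵐ z ∂ν, z = 0) :
    0 < ∫ z, min ‖z‖ 1 ∂ν := by
  have h0 : ∀ z : ℂ, 0 ≤ min ‖z‖ 1 := fun z => by positivity
  rcases (integral_nonneg (μ := ν) (f := fun z : ℂ => min ‖z‖ 1) h0).lt_or_eq with h1 | h1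
  · exact h1
  · exfalso
    have hi : Integrable (fun z : ℂ => min ‖z‖ 1) ν :=
      Integrable.of_bound (C := 1) (measurable_norm.min measurable_const).aestronglyMeasurable
        (Filter.Eventually.of_forall fun z => by
          rw [Real.norm_of_nonneg (h0 z)]; exact min_le_right _ _)
    have := (integral_eq_zero_iff_of_nonneg h0 hi).1 h1.symm
    refine h ?_
    filter_upwards [this] with z hz
    by_contra hne
    have : 0 < min ‖z‖ 1 := lt_min (norm_pos_iff.2 hne) one_pos
    exact this.ne' hz

lemma integral_min_norm_one_of_unimodular {ν : Measure ℂ} [IsProbabilityMeasure ν]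
    (h : IsUnimodularLaw ν) : ∫ z, min ‖z‖ 1 ∂ν = 1 := by
  have : (fun z : ℂ => min ‖z‖ 1) =ᵐ[ν] fun _ => 1 := by
    filter_upwards [h] with z hz; simp [hz]
  rw [integral_congr_ae this]; simp

end LowerEstimate

section Kahane

/-! ### The Rademacher law -/

/-- The Rademacher law, as a measure on `ℂ`. -/
def rademacherLaw : Measure ℂ := (2⁻¹ : ℝ≥0∞) • (Measure.dirac 1 + Measure.dirac (-1))

instance : IsProbabilityMeasure rademacherLaw := by
  constructor
  simp only [rademacherLaw, Measure.smul_apply, Measure.add_apply, measure_univ, smul_eq_mul]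
  rw [one_add_one_eq_two, ENNReal.inv_mul_cancel (by simp) (by simp)]

lemma isSymmetricLaw_rademacherLaw : IsSymmetricLaw rademacherLaw := by
  refine ⟨measurable_neg, ?_⟩
  rw [rademacherLaw, Measure.map_smul, Measure.map_add _ _ measurable_neg,
    Measure.map_dirac' measurable_neg, Measure.map_dirac' measurable_neg, neg_neg, add_comm]

lemma isUnimodularLaw_rademacherLaw : IsUnimodularLaw rademacherLaw := by
  rw [IsUnimodularLaw, rademacherLaw]
  refine Measure.ae_smul_measure ?_ _
  rw [ae_add_measure_iff, ae_dirac_eq, ae_dirac_eq]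
  simp

/-- This links the product measure to the finite averages over signs that define cotype. -/
lemma pi_rademacherLaw (n : ℕ) :
    Measure.pi (fun _ : Fin n => rademacherLaw) =
      ((2⁻¹ : ℝ≥0∞) ^ n) • ∑ σ : Fin n → ℤˣ, Measure.dirac fun i => ((σ i : ℤ) : ℂ) := by
  refine Measure.pi_eq fun s hs => ?_
  have h1 : ∀ σ : Fin n → ℤˣ, (Measure.dirac fun i => ((σ i : ℤ) : ℂ)) (Set.univ.pi s) =
      ∏ i, (s i).indicator (1 : ℂ → ℝ≥0∞) ((σ i : ℤ) : ℂ) := by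
    intro σ
    rw [Measure.dirac_apply' _ (MeasurableSet.univ_pi hs)]
    by_cases h : ∀ i, ((σ i : ℤ) : ℂ) ∈ s i
    · rw [Set.indicator_of_mem (by simpa using h), Finset.prod_eq_one]
      · rfl
      · intro i _; rw [Set.indicator_of_mem (h i)]; rfl
    · rw [Set.indicator_of_notMem (by simpa using h)]
      push Not at h
      obtain ⟨i, hi⟩ := h
      exact (Finset.prod_eq_zero (Finset.mem_univ i) (Set.indicator_of_notMem hi _)).symm
  simp only [Measure.smul_apply, Measure.finsetSum_apply, h1, smul_eq_mul]
  rw [← Fintype.prod_sum (fun i (e : ℤˣ) => (s i).indicator (1 : ℂ → ℝ≥0∞) ((e : ℤ) : ℂ))]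
  have h2 : ∀ i, rademacherLaw (s i) =
      2⁻¹ * ∑ e : ℤˣ, (s i).indicator (1 : ℂ → ℝ≥0∞) ((e : ℤ) : ℂ) := by
    intro i
    rw [sum_units_int]
    simp [rademacherLaw, Measure.dirac_apply' _ (hs i), mul_add]
  simp_rw [h2]
  rw [Finset.prod_mul_distrib, Finset.prod_const, Finset.card_univ, Fintype.card_fin]

lemma lintegral_pi_rademacherLaw {n : ℕ} {f : (Fin n → ℂ) → ℝ} (hf : ∀ u, 0 ≤ f u) :
    ∫⁻ u, ENNReal.ofReal (f u) ∂(Measure.pi fun _ : Fin n => rademacherLaw) =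
      ENNReal.ofReal ((∑ σ : Fin n → ℤˣ, f fun i => ((σ i : ℤ) : ℂ)) / 2 ^ n) := by
  rw [pi_rademacherLaw, lintegral_smul_measure, lintegral_finsetSum_measure]
  simp only [lintegral_dirac, smul_eq_mul]
  rw [← ENNReal.ofReal_sum_of_nonneg fun σ _ => hf _, div_eq_inv_mul,
    ENNReal.ofReal_mul (by positivity), ← inv_pow, ENNReal.ofReal_pow (by positivity),
    ENNReal.ofReal_inv_of_pos (by positivity), ENNReal.ofReal_ofNat]

/-! ### Kahane's inequality -/

/-- With u = s + d and v = s - d this is 𝔼(s + ε d / 2)^4 ≤ (s² + d²)²: the left side is s⁴ + (3/2)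
s² d² + d⁴ / 16. -/
lemma two_point_fourth_power (u v : ℝ) :
    ((3 / 4 * u + 1 / 4 * v) ^ 4 + (1 / 4 * u + 3 / 4 * v) ^ 4) / 2 ≤
      ((u ^ 2 + v ^ 2) / 2) ^ 2 := by
  nlinarith [sq_nonneg ((u + v) * (u - v)), sq_nonneg ((u - v) ^ 2)]

/-- Convexity of x ↦ x^(r/2) reduces the claim to the fourth-power inequality for u^(r/2) and
v^(r/2). -/
lemma two_point_rpow {r u v : ℝ} (hr : 2 ≤ r) (hu : 0 ≤ u) (hv : 0 ≤ v) :
    ((3 / 4 * u + 1 / 4 * v) ^ (2 * r) + (1 / 4 * u + 3 / 4 * v) ^ (2 * r)) / 2 ≤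
      ((u ^ r + v ^ r) / 2) ^ 2 := by
  have hconv := convexOn_rpow (p := r / 2) (by linarith)
  have key : ∀ a b : ℝ, 0 ≤ a → 0 ≤ b → a + b = 1 →
      (a * u + b * v) ^ (2 * r) ≤ (a * u ^ (r / 2) + b * v ^ (r / 2)) ^ 4 := by
    intro a b ha hb hab
    have h1 := hconv.2 (x := u) (y := v) hu hv ha hb hab
    simp only [smul_eq_mul] at h1
    have h0 : 0 ≤ a * u + b * v := by positivity
    calc (a * u + b * v) ^ (2 * r) = ((a * u + b * v) ^ (r / 2)) ^ 4 := by
          rw [← Real.rpow_natCast, ← Real.rpow_mul h0]; congr 1; push_cast; ring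
      _ ≤ _ := by gcongr
  have hsq : ∀ a : ℝ, 0 ≤ a → (a ^ (r / 2)) ^ 2 = a ^ r := by
    intro a ha
    rw [← Real.rpow_natCast, ← Real.rpow_mul ha]; congr 1; push_cast; ring
  have h4 := two_point_fourth_power (u ^ (r / 2)) (v ^ (r / 2))
  rw [hsq u hu, hsq v hv] at h4
  linarith [key (3 / 4) (1 / 4) (by norm_num) (by norm_num) (by norm_num),
    key (1 / 4) (3 / 4) (by norm_num) (by norm_num) (by norm_num)]

variable {X : Type*} [NormedAddCommGroup X] [NormedSpace ℂ X]

lemma norm_add_half_smul_le (a b : X) :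
    ‖a + (1 / 2 : ℂ) • b‖ ≤ 3 / 4 * ‖a + b‖ + 1 / 4 * ‖a - b‖ := by
  have : a + (1 / 2 : ℂ) • b = (3 / 4 : ℂ) • (a + b) + (1 / 4 : ℂ) • (a - b) := by module
  rw [this]
  refine (norm_add_le _ _).trans ?_
  rw [norm_smul, norm_smul]
  norm_num

lemma two_point_norm_rpow {r : ℝ} (hr : 2 ≤ r) (a b : X) :
    (‖a + (1 / 2 : ℂ) • b‖ ^ (2 * r) + ‖a - (1 / 2 : ℂ) • b‖ ^ (2 * r)) / 2 ≤
      ((‖a + b‖ ^ r + ‖a - b‖ ^ r) / 2) ^ 2 := by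
  refine le_trans ?_ (two_point_rpow hr (norm_nonneg (a + b)) (norm_nonneg (a - b)))
  have h1 := norm_add_half_smul_le a b
  have h2 := norm_add_half_smul_le a (-b)
  rw [smul_neg, ← sub_eq_add_neg, ← sub_eq_add_neg, sub_neg_eq_add, add_comm] at h2
  gcongr

/-- Minkowski's inequality for sums of vectors in the plane, in squared form. -/
lemma sum_sq_add_sum_sq_le {ι : Type*} (s : Finset ι) (f g h : ι → ℝ)
    (hh : ∀ i, 0 ≤ h i) (hle : ∀ i, f i ^ 2 + g i ^ 2 ≤ h i ^ 2) :
    (∑ i ∈ s, f i) ^ 2 + (∑ i ∈ s, g i) ^ 2 ≤ (∑ i ∈ s, h i) ^ 2 := by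
  simp only [sq (∑ i ∈ s, _), Finset.sum_mul_sum, ← Finset.sum_add_distrib]
  refine Finset.sum_le_sum fun i _ => Finset.sum_le_sum fun j _ => ?_
  refine abs_le_of_sq_le_sq' ?_ (mul_nonneg (hh i) (hh j)) |>.2
  calc (f i * f j + g i * g j) ^ 2 ≤ (f i ^ 2 + g i ^ 2) * (f j ^ 2 + g j ^ 2) := by
        nlinarith [sq_nonneg (f i * g j - g i * f j)]
    _ ≤ h i ^ 2 * h j ^ 2 := mul_le_mul (hle i) (hle j) (by positivity) (by positivity)
    _ = _ := by ring

lemma sum_signs_succ {n : ℕ} {M : Type*} [AddCommMonoid M] (f : (Fin (n + 1) → ℤˣ) → M) :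
    ∑ σ, f σ = ∑ τ : Fin n → ℤˣ, f (Fin.cons 1 τ) + ∑ τ : Fin n → ℤˣ, f (Fin.cons (-1) τ) := by
  rw [← (Fin.consEquiv fun _ : Fin (n + 1) => ℤˣ).sum_comp, Fintype.sum_prod_type, sum_units_int]
  rfl

lemma average_le_sq_of_le {N a₁ a₂ b₁ b₂ h : ℝ} (hN : 0 < N) (h₁ : a₁ / N ≤ (b₁ / N) ^ 2)
    (h₂ : a₂ / N ≤ (b₂ / N) ^ 2) (hb : b₁ ^ 2 + b₂ ^ 2 ≤ h ^ 2 / 2) :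
    (a₁ + a₂) / (N * 2) ≤ (h / (N * 2)) ^ 2 := by
  calc (a₁ + a₂) / (N * 2) = (a₁ / N + a₂ / N) / 2 := by ring
    _ ≤ ((b₁ / N) ^ 2 + (b₂ / N) ^ 2) / 2 := by gcongr
    _ = (b₁ ^ 2 + b₂ ^ 2) / (2 * N ^ 2) := by ring
    _ ≤ (h ^ 2 / 2) / (2 * N ^ 2) := by gcongr
    _ = _ := by ring

/-- Hypercontractivity from L_r to L_{2r} with noise parameter 1/2, by induction on the number of
signs. The free vector a absorbs the sign that is peeled off; the induction hypothesis handles the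
other signs, and the two-point inequality handles that one. -/
lemma hypercontractive_signs {r : ℝ} (hr : 2 ≤ r) :
    ∀ (n : ℕ) (x : Fin n → X) (a : X),
      (∑ σ : Fin n → ℤˣ, ‖a + (1 / 2 : ℂ) • ∑ i, ((σ i : ℤ) : ℂ) • x i‖ ^ (2 * r)) / 2 ^ n ≤
        ((∑ σ : Fin n → ℤˣ, ‖a + ∑ i, ((σ i : ℤ) : ℂ) • x i‖ ^ r) / 2 ^ n) ^ 2
  | 0, x, a => by
    simp only [Finset.univ_unique, Finset.sum_singleton, Finset.univ_eq_empty, Finset.sum_empty,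
      smul_zero, add_zero, pow_zero, div_one]
    rw [mul_comm, Real.rpow_mul (norm_nonneg a)]
    norm_cast
  | n + 1, x, a => by
    have ih := hypercontractive_signs hr n (fun i => x i.succ)
    rw [sum_signs_succ, sum_signs_succ]
    simp only [Fin.sum_univ_succ, Fin.cons_zero, Fin.cons_succ, Units.val_one, Int.cast_one,
      one_smul, Units.val_neg, Int.cast_neg, neg_smul, smul_add, smul_neg, ← add_assoc,
      ← sub_eq_add_neg]
    set S : (Fin n → ℤˣ) → X := fun σ => ∑ i, ((σ i : ℤ) : ℂ) • x i.succ with hS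
    have i1 := ih (a + (1 / 2 : ℂ) • x 0)
    have i2 := ih (a - (1 / 2 : ℂ) • x 0)
    -- Minkowski's inequality exchanges the square over the peeled sign with the sum over the
    -- others; the two-point inequality then applies for each fixed σ.
    have hmink := sum_sq_add_sum_sq_le Finset.univ
      (fun σ => ‖a + (1 / 2 : ℂ) • x 0 + S σ‖ ^ r) (fun σ => ‖a - (1 / 2 : ℂ) • x 0 + S σ‖ ^ r)
      (fun σ => (‖a + x 0 + S σ‖ ^ r + ‖a - x 0 + S σ‖ ^ r) / √2) (fun σ => by positivity)
      (fun σ => by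
        have := two_point_norm_rpow hr (a + S σ) (x 0)
        rw [add_right_comm a (S σ), add_sub_right_comm a (S σ), add_right_comm a (S σ),
          add_sub_right_comm a (S σ), mul_comm 2 r, Real.rpow_mul (norm_nonneg _),
          Real.rpow_mul (norm_nonneg _)] at this
        rw [div_pow, Real.sq_sqrt (by norm_num)]
        norm_cast at this ⊢
        linarith)
    rw [← Finset.sum_div, Finset.sum_add_distrib, div_pow, Real.sq_sqrt (by norm_num)] at hmink
    have h2n : (0 : ℝ) < 2 ^ n := by positivity
    simp only [hS] at hmink
    rw [pow_succ]
    exact average_le_sq_of_le h2n i1 i2 hmink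

/-- Hypercontractivity gives the reverse Hölder inequality 𝔼 f^(2r) ≤ 4^r (𝔼 f^r)². Splitting f^r at
a level t bounds it by t^(r-1) f where f ≤ t and by f^(2r) / t^r elsewhere. -/
lemma kahane_signs {r : ℝ} (hr : 2 ≤ r) {n : ℕ} (x : Fin n → X) :
    ((∑ σ : Fin n → ℤˣ, ‖∑ i, ((σ i : ℤ) : ℂ) • x i‖ ^ r) / 2 ^ n) ^ (1 / r) ≤
      4 ^ (r + 1) * ((∑ σ : Fin n → ℤˣ, ‖∑ i, ((σ i : ℤ) : ℂ) • x i‖) / 2 ^ n) := by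
  set f : (Fin n → ℤˣ) → ℝ := fun σ => ‖∑ i, ((σ i : ℤ) : ℂ) • x i‖ with hf
  have hf0 : ∀ σ, 0 ≤ f σ := fun σ => norm_nonneg _
  have hr0 : 0 < r := by linarith
  have h2n : (0 : ℝ) < 2 ^ n := by positivity
  have h4r : (0 : ℝ) < 4 ^ r := by positivity
  set M : ℝ := (∑ σ, f σ ^ r) / 2 ^ n with hM
  have hM0 : 0 ≤ M := div_nonneg (Finset.sum_nonneg fun σ _ => Real.rpow_nonneg (hf0 σ) _) h2n.le
  have hM1 : 0 ≤ (∑ σ, f σ) / 2 ^ n := div_nonneg (Finset.sum_nonneg fun σ _ => hf0 σ) h2n.le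
  rcases hM0.eq_or_lt with h0 | hpos
  · rw [← h0, Real.zero_rpow (by positivity)]; positivity
  have hyp : (∑ σ, f σ ^ (2 * r)) / 2 ^ n ≤ 4 ^ r * M ^ 2 := by
    have := hypercontractive_signs hr n x 0
    simp only [zero_add, norm_smul] at this
    have e : ∀ σ, (‖(1 / 2 : ℂ)‖ * f σ) ^ (2 * r) = (4 ^ r)⁻¹ * f σ ^ (2 * r) := by
      intro σ
      rw [Real.mul_rpow (norm_nonneg _) (hf0 σ)]
      congr 1
      rw [Real.rpow_mul (norm_nonneg _), ← Real.inv_rpow (by norm_num)]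
      congr 1
      norm_num
    simp only [hf] at e
    simp_rw [e] at this
    rw [← Finset.mul_sum, mul_div_assoc, inv_mul_le_iff₀ h4r] at this
    exact this
  -- This level makes the contribution of f^(2r) / t^r at most M / 2, which is absorbed on the left.
  set t : ℝ := (2 * 4 ^ r * M) ^ (1 / r) with ht
  have ht0 : 0 < t := by positivity
  have htr : t ^ r = 2 * 4 ^ r * M := by
    rw [ht, ← Real.rpow_mul (by positivity), one_div_mul_cancel hr0.ne', Real.rpow_one]
  have hpt : ∀ σ, f σ ^ r ≤ t ^ (r - 1) * f σ + f σ ^ (2 * r) / t ^ r := by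
    intro σ
    rcases le_total (f σ) t with h | h
    · have : f σ ^ r ≤ t ^ (r - 1) * f σ := by
        rcases (hf0 σ).eq_or_lt with h0 | h0
        · rw [← h0, Real.zero_rpow hr0.ne', mul_zero]
        · calc f σ ^ r = f σ ^ (r - 1) * f σ := by
                rw [← Real.rpow_add_one h0.ne']; congr 1; ring
            _ ≤ _ := by gcongr; linarith
      have : 0 ≤ f σ ^ (2 * r) / t ^ r := by have := hf0 σ; positivity
      linarith
    · have h1 : f σ ^ r ≤ f σ ^ (2 * r) / t ^ r := by
        rw [le_div_iff₀ (by positivity), two_mul, Real.rpow_add (ht0.trans_le h)]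
        gcongr
      have : 0 ≤ t ^ (r - 1) * f σ := by have := hf0 σ; positivity
      linarith
  have hsum : M ≤ t ^ (r - 1) * ((∑ σ, f σ) / 2 ^ n) + ((∑ σ, f σ ^ (2 * r)) / 2 ^ n) / t ^ r := by
    have := Finset.sum_le_sum fun σ (_ : σ ∈ Finset.univ) => hpt σ
    rw [Finset.sum_add_distrib, ← Finset.mul_sum, ← Finset.sum_div] at this
    calc M ≤ (t ^ (r - 1) * ∑ σ, f σ + (∑ σ, f σ ^ (2 * r)) / t ^ r) / 2 ^ n := by
          rw [hM]; gcongr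
      _ = _ := by ring
  have h3 : ((∑ σ, f σ ^ (2 * r)) / 2 ^ n) / t ^ r ≤ M / 2 := by
    rw [htr, div_le_iff₀ (by positivity)]
    nlinarith
  have h4 : M / 2 ≤ t ^ (r - 1) * ((∑ σ, f σ) / 2 ^ n) := by linarith
  have h5 : t * (M / 2) ≤ 2 * 4 ^ r * M * ((∑ σ, f σ) / 2 ^ n) := by
    rw [← htr]
    calc t * (M / 2) ≤ t * (t ^ (r - 1) * ((∑ σ, f σ) / 2 ^ n)) := by gcongr
      _ = _ := by
        rw [← mul_assoc]; congr 1
        rw [mul_comm, ← Real.rpow_add_one ht0.ne']; congr 1; ring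
  have h6 : t ≤ 4 ^ (r + 1) * ((∑ σ, f σ) / 2 ^ n) := by
    rw [Real.rpow_add_one (by norm_num)]
    refine le_of_mul_le_mul_right ?_ (half_pos hpos)
    calc _ ≤ _ := h5
      _ = _ := by ring
  refine le_trans ?_ h6
  rw [ht]
  have h1r : (1 : ℝ) ≤ 4 ^ r := Real.one_le_rpow (by norm_num) hr0.le
  refine Real.rpow_le_rpow hM0 ?_ (by positivity)
  nlinarith

/-! ### Linear polynomials -/

/-- The linear polynomial `z ↦ ∑ zᵢ xᵢ`. -/
def TetrahedralPolynomial.linear {X : Type*} [NormedAddCommGroup X] {n : ℕ}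
    (x : Fin n → X) : TetrahedralPolynomial n X :=
  fun A => ∑ i, if A = {i} then x i else 0

lemma TetrahedralPolynomial.eval_linear {n : ℕ} (x : Fin n → X) (z : Fin n → ℂ) :
    (linear x).eval z = ∑ i, z i • x i := by
  simp only [eval, linear, Finset.smul_sum, smul_ite, smul_zero]
  rw [Finset.sum_comm]
  simp

lemma TetrahedralPolynomial.card_le_one_of_linear {X : Type*} [NormedAddCommGroup X] {n : ℕ}
    (x : Fin n → X) (A : Finset (Fin n))
    (hA : linear x A ≠ 0) : A.card ≤ 1 := by
  obtain ⟨i, -, hi⟩ := Finset.exists_ne_zero_of_sum_ne_zero hA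
  have : A = {i} := by by_contra h; simp [h] at hi
  simp [this]

lemma eLpNorm'_pi_rademacherLaw {n : ℕ} {p : ℝ} (hp : 0 < p) (x : Fin n → X) :
    eLpNorm' (linear x).eval p (Measure.pi fun _ => rademacherLaw) =
      ENNReal.ofReal
        (((∑ σ : Fin n → ℤˣ, ‖∑ i, ((σ i : ℤ) : ℂ) • x i‖ ^ p) / 2 ^ n) ^ (1 / p)) := by
  rw [eLpNorm'_eq_lintegral_enorm]
  have : ∀ u, ‖(linear x).eval u‖ₑ ^ p = ENNReal.ofReal (‖∑ i, u i • x i‖ ^ p) := by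
    intro u
    rw [eval_linear, ← ENNReal.ofReal_rpow_of_nonneg (norm_nonneg _) hp.le, ofReal_norm]
  simp_rw [this]
  rw [lintegral_pi_rademacherLaw (f := fun u => ‖∑ i, u i • x i‖ ^ p) (fun u => by positivity),
    ENNReal.ofReal_rpow_of_nonneg (by positivity) (by positivity)]

/-- Kahane's inequality for Rademacher sums. -/
lemma kahane_rademacher {n : ℕ} {r p : ℝ} (hr : 2 ≤ r) (hp : 1 ≤ p) (x : Fin n → X) :
    eLpNorm' (linear x).eval r (Measure.pi fun _ => rademacherLaw) ≤
      ((4 ^ (r + 1) : ℝ≥0) : ℝ≥0∞) *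
        eLpNorm' (linear x).eval p (Measure.pi fun _ => rademacherLaw) := by
  have h1 := eLpNorm'_le_eLpNorm'_of_exponent_le zero_lt_one hp
    (μ := Measure.pi fun _ => rademacherLaw)
    (linear x).stronglyMeasurable_eval.aestronglyMeasurable
  refine le_trans ?_ (mul_le_mul_right h1 _)
  rw [eLpNorm'_pi_rademacherLaw (by linarith), eLpNorm'_pi_rademacherLaw zero_lt_one]
  have h4 : ((4 ^ (r + 1) : ℝ≥0) : ℝ≥0∞) = ENNReal.ofReal (4 ^ (r + 1)) := by
    rw [ENNReal.ofReal]; congr 1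
    rw [Real.toNNReal_rpow_of_nonneg (by norm_num), Real.toNNReal_ofNat]
  rw [h4, ← ENNReal.ofReal_mul (by positivity)]
  apply ENNReal.ofReal_le_ofReal
  simpa using kahane_signs hr x

/-- Kahane's inequality for Steinhaus sums. -/
lemma kahane_steinhaus [CompleteSpace X] {r p : ℝ} (hr : 2 ≤ r) (hp : 1 ≤ p) :
    ∃ K : ℝ≥0, 1 ≤ K ∧ ∀ (n : ℕ) (x : Fin n → X),
      eLpNorm' (linear x).eval r (Measure.pi fun _ => steinhausLaw) ≤
        K * eLpNorm' (linear x).eval p (Measure.pi fun _ => steinhausLaw) := by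
  set c : ℝ≥0 := contrConst (1 / 1) * contrConst 1 * contrConst 1 with hc
  have hc1 : 1 ≤ c := one_le_mul (one_le_mul (one_le_contrConst (by norm_num))
    (one_le_contrConst zero_le_one)) (one_le_contrConst zero_le_one)
  refine ⟨c * 4 ^ (r + 1) * c, one_le_mul (one_le_mul hc1
    (NNReal.one_le_rpow (by norm_num) (by linarith))) hc1, fun n x => ?_⟩
  -- Steinhaus and Rademacher sums are compared in both directions: once in L_r and, after Kahane's
  -- inequality for signs, once in L_p.
  have h1 := eLpNorm'_eval_unimodular_le (p := r) (by linarith) isSymmetricLaw_rademacherLaw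
    isSymmetricLaw_steinhausLaw isUnimodularLaw_steinhausLaw zero_lt_one
    (integral_min_norm_one_of_unimodular isUnimodularLaw_rademacherLaw) (linear x) (m := 1)
    (card_le_one_of_linear x)
  have h2 := eLpNorm'_eval_unimodular_le (p := p) hp isSymmetricLaw_steinhausLaw
    isSymmetricLaw_rademacherLaw isUnimodularLaw_rademacherLaw zero_lt_one
    (integral_min_norm_one_of_unimodular isUnimodularLaw_steinhausLaw) (linear x) (m := 1)
    (card_le_one_of_linear x)
  rw [pow_one] at h1 h2
  rw [ENNReal.coe_mul, ENNReal.coe_mul, mul_assoc, mul_assoc]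
  exact h1.trans (mul_le_mul_right ((kahane_rademacher hr hp x).trans (mul_le_mul_right h2 _)) _)

end Kahane

section Cotype

/-! ### Cotype -/

lemma sum_rpow_le_of_exponent_le {ι : Type*} (s : Finset ι) {a : ι → ℝ} (ha : ∀ i, 0 ≤ a i)
    {q r : ℝ} (hq : 0 < q) (hqr : q ≤ r) :
    ∑ i ∈ s, a i ^ r ≤ ((∑ i ∈ s, a i ^ q) ^ (1 / q)) ^ r := by
  set S := (∑ i ∈ s, a i ^ q) ^ (1 / q) with hS
  have hsum0 : 0 ≤ ∑ i ∈ s, a i ^ q := Finset.sum_nonneg fun i _ => Real.rpow_nonneg (ha i) _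
  have hS0 : 0 ≤ S := Real.rpow_nonneg hsum0 _
  have hSq : S ^ q = ∑ i ∈ s, a i ^ q := by
    rw [hS, ← Real.rpow_mul hsum0, one_div_mul_cancel hq.ne', Real.rpow_one]
  have hle : ∀ i ∈ s, a i ≤ S := fun i hi => by
    rw [← Real.rpow_le_rpow_iff (ha i) hS0 hq, hSq]
    exact Finset.single_le_sum (f := fun i => a i ^ q) (fun i _ => Real.rpow_nonneg (ha i) _) hi
  have hsplit : ∀ t : ℝ, 0 ≤ t → t ^ r = t ^ q * t ^ (r - q) := fun t ht => by
    rw [← Real.rpow_add_of_nonneg ht hq.le (by linarith)]; congr 1; ring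
  rw [hsplit S hS0, hSq, Finset.sum_mul]
  refine Finset.sum_le_sum fun i hi => ?_
  rw [hsplit _ (ha i)]
  exact mul_le_mul_of_nonneg_left (Real.rpow_le_rpow (ha i) (hle i hi) (by linarith))
    (Real.rpow_nonneg (ha i) _)

variable {X : Type*} [NormedAddCommGroup X] [NormedSpace ℂ X]

/-- Cotype q passes to every exponent r ≥ q: ℓ_r norms decrease in the exponent and L_r norms on a
probability space increase. -/
lemma HasCotype.exists_sum_enorm_rpow_le {q r : ℝ} (h : HasCotype X q) (hqr : q ≤ r) :
    ∃ C : ℝ≥0, 1 ≤ C ∧ ∀ (N : ℕ) (y : Fin N → X), ∑ j, ‖y j‖ₑ ^ r ≤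
      (C * eLpNorm' (linear y).eval r (Measure.pi fun _ => rademacherLaw)) ^ r := by
  obtain ⟨hq2, C, hC1, hC⟩ := h
  have hq0 : 0 < q := by linarith
  have hr0 : 0 < r := by linarith
  refine ⟨C.toNNReal, by rwa [Real.one_le_toNNReal], fun N y => ?_⟩
  have h1 : ∑ j, ‖y j‖ₑ ^ r = ENNReal.ofReal (∑ j, ‖y j‖ ^ r) := by
    rw [ENNReal.ofReal_sum_of_nonneg fun j _ => by positivity]
    refine Finset.sum_congr rfl fun j _ => ?_
    rw [← ENNReal.ofReal_rpow_of_nonneg (norm_nonneg _) hr0.le, ofReal_norm]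
  have h2 : rademacherMoment q y =
      (∑ σ : Fin N → ℤˣ, ‖∑ i, ((σ i : ℤ) : ℂ) • y i‖ ^ q) / 2 ^ N := by
    rw [rademacherMoment]
    simp only [Int.cast_smul_eq_zsmul]
  have h3 := eLpNorm'_le_eLpNorm'_of_exponent_le hq0 hqr
    (μ := Measure.pi fun _ => rademacherLaw)
    (linear y).stronglyMeasurable_eval.aestronglyMeasurable
  rw [h1]
  refine (ENNReal.ofReal_le_ofReal
    (sum_rpow_le_of_exponent_le _ (fun j => norm_nonneg (y j)) hq0 hqr)).trans ?_
  rw [← ENNReal.ofReal_rpow_of_nonneg (by positivity) hr0.le]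
  refine ENNReal.rpow_le_rpow ?_ hr0.le
  refine (ENNReal.ofReal_le_ofReal (hC N y)).trans ?_
  rw [ENNReal.ofReal_mul (by linarith), h2, ← eLpNorm'_pi_rademacherLaw hq0]
  exact mul_le_mul_right h3 _

/-! ### Sums with random multipliers -/

variable {n : ℕ} {r : ℝ}

lemma stronglyMeasurable_eval_comp_mul (P : TetrahedralPolynomial n X) {B : ℂ → ℂ}
    (hB : Measurable B) :
    StronglyMeasurable fun x : (Fin n → ℂ) × (Fin n → ℂ) =>
      P.eval ((fun i => B (x.2 i)) * x.1) := by
  refine P.stronglyMeasurable_eval.comp_measurable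
    (measurable_pi_lambda _ fun i => Measurable.mul ?_ (by fun_prop))
  exact hB.comp (by fun_prop)

/-- The seminorm of `∑ B(zᵢ) wᵢ xᵢ`, where the `wᵢ` have law `ρ` and the `zᵢ` have law `ν`. -/
def multNorm (r : ℝ) (ρ ν : Measure ℂ) (x : Fin n → X) (B : ℂ → ℂ) : ℝ≥0∞ :=
  eLpNorm' (fun y : (Fin n → ℂ) × (Fin n → ℂ) => (linear x).eval ((fun i => B (y.2 i)) * y.1)) r
    ((Measure.pi fun _ => ρ).prod (Measure.pi fun _ => ν))

lemma multNorm_le_of_norm_le (hr : 1 ≤ r) {ρ ν : Measure ℂ} [IsProbabilityMeasure ρ]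
    [IsProbabilityMeasure ν] (hρ : IsSymmetricLaw ρ) (x : Fin n → X) {B B' : ℂ → ℂ}
    (hB : Measurable B) (hB' : Measurable B') {R : ℝ} (hR : 0 < R)
    (h : ∀ z, ‖B z‖ ≤ R * ‖B' z‖) :
    multNorm r ρ ν x B ≤ contrConst R * multNorm r ρ ν x B' := by
  refine eLpNorm'_prod_le_of_ae_section_le_left (zero_lt_one.trans_le hr)
    (stronglyMeasurable_eval_comp_mul _ hB) (stronglyMeasurable_eval_comp_mul _ hB')
    ENNReal.coe_ne_top (Filter.Eventually.of_forall fun z => ?_)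
  have := eLpNorm'_eval_mul_le_of_norm_le hr hρ (linear x) (card_le_one_of_linear x) hR
    (z := fun i => B (z i)) (y := fun i => B' (z i)) fun i => h (z i)
  rwa [pow_one] at this

/-- The left side is the probability that exactly one of M + 1 independent events with probabilities
b j occurs: the singleton terms in the expansion of ∏ (b j + (1 - b j)) = 1. -/
lemma sum_single_hit_le_one {M : ℕ} {b : Fin (M + 1) → ℝ} (h0 : ∀ j, 0 ≤ b j) (h1 : ∀ j, b j ≤ 1) :
    ∑ j, b j * ∏ l : Fin M, (1 - b (j.succAbove l)) ≤ 1 := by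
  have e := Finset.prod_add b (fun j => 1 - b j) Finset.univ
  simp only [add_sub_cancel, Finset.prod_const_one] at e
  refine le_of_le_of_eq ?_ e.symm
  have hi : ∀ j : Fin (M + 1), b j * ∏ l : Fin M, (1 - b (j.succAbove l)) =
      (∏ i ∈ {j}, b i) * ∏ i ∈ Finset.univ \ {j}, (1 - b i) := by
    intro j
    rw [Finset.prod_singleton, ← Finset.compl_eq_univ_sdiff, ← Fin.image_succAbove_univ,
      Finset.prod_image Fin.succAbove_right_injective.injOn]
  simp_rw [hi]
  rw [← Finset.sum_image (f := fun t : Finset (Fin (M + 1)) =>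
    (∏ i ∈ t, b i) * ∏ i ∈ Finset.univ \ t, (1 - b i)) (g := fun j => ({j} : Finset _))
    (fun a _ b _ h => by simpa using h)]
  refine Finset.sum_le_sum_of_subset_of_nonneg (by intro t; simp) fun t _ _ => ?_
  exact mul_nonneg (Finset.prod_nonneg fun i _ => h0 i)
    (Finset.prod_nonneg fun i _ => sub_nonneg.2 (h1 i))

/-- For `M + 1` independent copies `Z` of a vector, the multiplier that selects the coordinates
hit by the copy `j` and missed by all the others. -/
def hitMult (a : ℂ → ℝ) {M : ℕ} (j : Fin (M + 1)) (Z : Fin (M + 1) → Fin n → ℂ) (i : Fin n) : ℝ :=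
  a (Z j i) * ∏ l : Fin M, (1 - a (Z (j.succAbove l) i))

lemma measurable_hitMult {a : ℂ → ℝ} (ha : Measurable a) {M : ℕ} (j : Fin (M + 1)) (i : Fin n) :
    Measurable fun Z : Fin (M + 1) → Fin n → ℂ => hitMult a j Z i := by
  unfold hitMult
  refine Measurable.mul (ha.comp (by fun_prop)) (Finset.measurable_prod _ fun l _ => ?_)
  exact measurable_const.sub (ha.comp (by fun_prop))

lemma stronglyMeasurable_eval_hitMult (P : TetrahedralPolynomial n X) {a : ℂ → ℝ}
    (ha : Measurable a) {M : ℕ} (j : Fin (M + 1)) :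
    StronglyMeasurable fun y : (Fin n → ℂ) × (Fin (M + 1) → Fin n → ℂ) =>
      P.eval ((fun i => (hitMult a j y.2 i : ℂ)) * y.1) := by
  refine P.stronglyMeasurable_eval.comp_measurable
    (measurable_pi_lambda _ fun i => Measurable.mul ?_ (by fun_prop))
  exact Complex.measurable_ofReal.comp ((measurable_hitMult ha j i).comp measurable_snd)

lemma integral_prod_one_sub {ν : Measure ℂ} [IsProbabilityMeasure ν] {a : ℂ → ℝ}
    (ha : Measurable a) (h0 : ∀ z, 0 ≤ a z) (h1 : ∀ z, a z ≤ 1) (M : ℕ) (i : Fin n) :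
    ∫ Z : Fin M → Fin n → ℂ, ∏ l, (1 - a (Z l i))
      ∂(Measure.pi fun _ => Measure.pi fun _ => ν) = (1 - ∫ z, a z ∂ν) ^ M := by
  have hint : Integrable a ν := Integrable.of_bound (C := 1) ha.aestronglyMeasurable
    (Filter.Eventually.of_forall fun z => by rw [Real.norm_of_nonneg (h0 z)]; exact h1 z)
  rw [integral_fintype_prod_eq_prod (fun _ (z : Fin n → ℂ) => 1 - a (z i))]
  have : ∫ z : Fin n → ℂ, (1 - a (z i)) ∂(Measure.pi fun _ => ν) = 1 - ∫ z, a z ∂ν := by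
    have hpres := measurePreserving_eval (fun _ : Fin n => ν) i
    rw [← integral_map (φ := fun z : Fin n → ℂ => z i) (f := fun z => 1 - a z)
      (measurable_pi_apply i).aemeasurable (measurable_const.sub ha).aestronglyMeasurable]
    rw [show Measure.map (fun z : Fin n → ℂ => z i) (Measure.pi fun _ => ν) = ν from hpres.map_eq,
      integral_sub (integrable_const _) hint]
    simp
  simp [this]

/-- Averaging over the copies other than `j`. -/
lemma enorm_eval_le_eLpNorm'_hitMult [CompleteSpace X] (hr : 1 ≤ r) {ν : Measure ℂ}
    [IsProbabilityMeasure ν] {a : ℂ → ℝ} (ha : Measurable a) (h0 : ∀ z, 0 ≤ a z)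
    (h1 : ∀ z, a z ≤ 1) {M : ℕ}
    (hM : M * ∫ z, a z ∂ν ≤ 1 / 2) (x : Fin n → X) (z w : Fin n → ℂ) :
    ‖(linear x).eval ((fun i => (a (z i) : ℂ)) * w)‖ₑ ≤
      2 * eLpNorm' (fun Z : Fin M → Fin n → ℂ => (linear x).eval
        ((fun i => ((a (z i) * ∏ l, (1 - a (Z l i)) : ℝ) : ℂ)) * w)) r
        (Measure.pi fun _ => Measure.pi fun _ => ν) := by
  set τ := ∫ z, a z ∂ν with hτ
  have hτ0 : 0 ≤ τ := integral_nonneg h0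
  have hint : Integrable a ν := Integrable.of_bound (C := 1) ha.aestronglyMeasurable
    (Filter.Eventually.of_forall fun z => by rw [Real.norm_of_nonneg (h0 z)]; exact h1 z)
  have hτ1 : τ ≤ 1 := by
    calc τ ≤ ∫ _, (1 : ℝ) ∂ν := integral_mono hint (integrable_const _) h1
      _ = 1 := by simp
  -- Bernoulli's inequality: with M τ ≤ 1/2, a coordinate escapes the other M copies with weight at
  -- least 1/2 on average.
  have hhalf : 1 / 2 ≤ (1 - τ) ^ M := by
    have := one_add_mul_le_pow (a := -τ) (by linarith) M
    rw [← sub_eq_add_neg] at this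
    linarith
  have hmeas : ∀ i, Measurable fun Z : Fin M → Fin n → ℂ => ∏ l, (1 - a (Z l i)) := fun i =>
    Finset.measurable_prod _ fun l _ => measurable_const.sub (ha.comp (by fun_prop))
  have hsm : StronglyMeasurable fun Z : Fin M → Fin n → ℂ => (linear x).eval
        ((fun i => ((a (z i) * ∏ l, (1 - a (Z l i)) : ℝ) : ℂ)) * w) := by
    refine (linear x).stronglyMeasurable_eval.comp_measurable
      (measurable_pi_lambda _ fun i => Measurable.mul_const ?_ _)
    exact Complex.measurable_ofReal.comp ((hmeas i).const_mul _)
  have hI : ∫ Z : Fin M → Fin n → ℂ, (linear x).eval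
        ((fun i => ((a (z i) * ∏ l, (1 - a (Z l i)) : ℝ) : ℂ)) * w)
        ∂(Measure.pi fun _ => Measure.pi fun _ => ν) =
      (((1 - τ) ^ M : ℝ) : ℂ) • (linear x).eval ((fun i => (a (z i) : ℂ)) * w) := by
    simp only [eval_linear, Pi.mul_apply]
    rw [integral_finsetSum, Finset.smul_sum]
    · refine Finset.sum_congr rfl fun i _ => ?_
      rw [integral_smul_const, integral_mul_const, integral_complex_ofReal, integral_const_mul,
        integral_prod_one_sub ha h0 h1, smul_smul]
      congr 1
      push_cast
      ring
    · intro i _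
      refine Integrable.smul_const (Integrable.mul_const (Integrable.ofReal
        (Integrable.const_mul ?_ _)) _) _
      refine Integrable.of_bound (C := 1) (hmeas i).aestronglyMeasurable
        (Filter.Eventually.of_forall fun Z => ?_)
      rw [norm_prod]
      refine Finset.prod_le_one (fun _ _ => norm_nonneg _) fun l _ => ?_
      rw [Real.norm_of_nonneg (sub_nonneg.2 (h1 _))]
      linarith [h0 (Z l i)]
  have hJ := enorm_integral_le_eLpNorm' hr (μ := Measure.pi fun _ => Measure.pi fun _ => ν) hsm
  rw [hI, enorm_smul] at hJ
  refine le_trans ?_ (mul_le_mul_right hJ 2)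
  rw [← mul_assoc]
  refine le_mul_of_one_le_left zero_le ?_
  rw [← ofReal_norm, Complex.norm_real, Real.norm_of_nonneg (by linarith), ← ENNReal.ofReal_ofNat,
    ← ENNReal.ofReal_mul (by norm_num), ENNReal.one_le_ofReal]
  linarith

/-- Copy j plays the role of the original selector, and the averaged estimate over the remaining
copies is applied conditionally on it and on w. -/
lemma multNorm_le_eLpNorm'_hitMult [CompleteSpace X] (hr : 1 ≤ r) {ρ ν : Measure ℂ}
    [IsProbabilityMeasure ρ] [IsProbabilityMeasure ν]
    {a : ℂ → ℝ} (ha : Measurable a) (h0 : ∀ z, 0 ≤ a z) (h1 : ∀ z, a z ≤ 1) {M : ℕ}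
    (hM : M * ∫ z, a z ∂ν ≤ 1 / 2) (x : Fin n → X) (j : Fin (M + 1)) :
    multNorm r ρ ν x (fun z => (a z : ℂ)) ≤
      2 * eLpNorm' (fun y : (Fin n → ℂ) × (Fin (M + 1) → Fin n → ℂ) =>
        (linear x).eval ((fun i => (hitMult a j y.2 i : ℂ)) * y.1)) r
        ((Measure.pi fun _ => ρ).prod (Measure.pi fun _ => Measure.pi fun _ => ν)) := by
  have hr0 : 0 < r := zero_lt_one.trans_le hr
  refine eLpNorm'_prod_le_of_ae_section_le hr0
    (stronglyMeasurable_eval_comp_mul _ (Complex.measurable_ofReal.comp ha))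
    (stronglyMeasurable_eval_hitMult _ ha j) (by simp) (Filter.Eventually.of_forall fun w => ?_)
  have hpres := (measurePreserving_piFinSuccAbove
    (fun _ : Fin (M + 1) => (Measure.pi fun _ : Fin n => ν)) j)
  have hg : StronglyMeasurable fun y : (Fin n → ℂ) × (Fin M → Fin n → ℂ) => (linear x).eval
        ((fun i => ((a (y.1 i) * ∏ l, (1 - a (y.2 l i)) : ℝ) : ℂ)) * w) := by
    refine (linear x).stronglyMeasurable_eval.comp_measurable
      (measurable_pi_lambda _ fun i => Measurable.mul_const ?_ _)
    refine Complex.measurable_ofReal.comp (Measurable.mul (ha.comp (by fun_prop)) ?_)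
    exact Finset.measurable_prod _ fun l _ => measurable_const.sub (ha.comp (by fun_prop))
  have e := eLpNorm'_comp_measurePreserving (p := r) hpres hg
  have e' : eLpNorm' (fun Z : Fin (M + 1) → Fin n → ℂ =>
      (linear x).eval ((fun i => (hitMult a j Z i : ℂ)) * w)) r
      (Measure.pi fun _ => Measure.pi fun _ => ν) = _ := e
  refine le_trans ?_ (mul_le_mul_right e'.ge 2)
  refine eLpNorm'_le_prod_of_enorm_le_section hr0 ?_ hg (by simp) fun z =>
    enorm_eval_le_eLpNorm'_hitMult hr ha h0 h1 hM x z w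
  refine (linear x).stronglyMeasurable_eval.comp_measurable
      (measurable_pi_lambda _ fun i => Measurable.mul_const ?_ _)
  exact Complex.measurable_ofReal.comp (ha.comp (measurable_pi_apply i))

/-- For a fixed outcome of the copies, cotype and the contraction principle. -/
lemma sum_lintegral_hitMult_le (hr : 1 ≤ r) {C : ℝ≥0} (hC : ∀ (N : ℕ) (y : Fin N → X),
      ∑ j, ‖y j‖ₑ ^ r ≤ (C * eLpNorm' (linear y).eval r (Measure.pi fun _ => rademacherLaw)) ^ r)
    {ρ : Measure ℂ} [IsProbabilityMeasure ρ] (hρ : IsSymmetricLaw ρ)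
    {a : ℂ → ℝ} (h0 : ∀ z, 0 ≤ a z) (h1 : ∀ z, a z ≤ 1) {M : ℕ} (x : Fin n → X)
    (Z : Fin (M + 1) → Fin n → ℂ) :
    ∫⁻ w, ∑ j, ‖(linear x).eval ((fun i => (hitMult a j Z i : ℂ)) * w)‖ₑ ^ r
        ∂(Measure.pi fun _ => ρ) ≤
      (C * contrConst 1 * eLpNorm' (linear x).eval r (Measure.pi fun _ => ρ)) ^ r := by
  have hr0 : 0 < r := zero_lt_one.trans_le hr
  have hnn : ∀ j i, 0 ≤ hitMult a j Z i := fun j i => mul_nonneg (h0 _)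
    (Finset.prod_nonneg fun l _ => sub_nonneg.2 (h1 _))
  -- A Rademacher combination of the M + 1 selected sums is again a multiplier sum. Its multipliers
  -- B θ i have modulus at most 1, as the hits on coordinate i sum to at most 1.
  set B : (Fin (M + 1) → ℂ) → Fin n → ℂ := fun θ i => ∑ j, θ j * hitMult a j Z i with hB
  have hBm : Measurable B := by
    refine measurable_pi_lambda _ fun i => ?_
    simp only [hB]
    fun_prop
  have hcomb : ∀ (θ : Fin (M + 1) → ℂ) (w : Fin n → ℂ),
      (linear fun j => (linear x).eval ((fun i => (hitMult a j Z i : ℂ)) * w)).eval θ =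
        (linear x).eval (B θ * w) := by
    intro θ w
    simp only [eval_linear, Pi.mul_apply, hB, Finset.smul_sum, smul_smul, Finset.sum_mul,
      Finset.sum_smul]
    rw [Finset.sum_comm]
    simp only [mul_assoc]
  have hm : StronglyMeasurable fun y : (Fin n → ℂ) × (Fin (M + 1) → ℂ) =>
      (linear x).eval (B y.2 * y.1) :=
    (linear x).stronglyMeasurable_eval.comp_measurable
      ((hBm.comp measurable_snd).mul measurable_fst)
  have hB1 : ∀ᵐ θ ∂(Measure.pi fun _ : Fin (M + 1) => rademacherLaw), ∀ i, ‖B θ i‖ ≤ 1 := by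
    filter_upwards [ae_pi_of_ae isUnimodularLaw_rademacherLaw] with θ hθ i
    refine (norm_sum_le _ _).trans (le_trans (le_of_eq ?_)
      (sum_single_hit_le_one (b := fun j => a (Z j i)) (fun _ => h0 _) (fun _ => h1 _)))
    refine Finset.sum_congr rfl fun j _ => ?_
    rw [norm_mul, hθ j, one_mul, Complex.norm_real, Real.norm_of_nonneg (hnn j i)]
    rfl
  have hcontr : eLpNorm' (fun y : (Fin n → ℂ) × (Fin (M + 1) → ℂ) =>
      (linear x).eval (B y.2 * y.1)) r
        ((Measure.pi fun _ => ρ).prod (Measure.pi fun _ => rademacherLaw)) ≤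
      contrConst 1 * eLpNorm' (linear x).eval r (Measure.pi fun _ => ρ) := by
    rw [← eLpNorm'_prod_fst (ν := Measure.pi fun _ : Fin (M + 1) => rademacherLaw)
      (linear x).stronglyMeasurable_eval]
    refine eLpNorm'_prod_le_of_ae_section_le_left hr0 hm
      ((linear x).stronglyMeasurable_eval.comp_measurable measurable_fst) ENNReal.coe_ne_top ?_
    filter_upwards [hB1] with θ hθ
    have := eLpNorm'_eval_mul_le hr hρ (linear x) (card_le_one_of_linear x) zero_lt_one
      (z := B θ) hθ
    rwa [pow_one] at this
  calc ∫⁻ w, ∑ j, ‖(linear x).eval ((fun i => (hitMult a j Z i : ℂ)) * w)‖ₑ ^ r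
        ∂(Measure.pi fun _ => ρ)
      ≤ ∫⁻ w, (C : ℝ≥0∞) ^ r * ∫⁻ θ, ‖(linear x).eval (B θ * w)‖ₑ ^ r
          ∂(Measure.pi fun _ => rademacherLaw) ∂(Measure.pi fun _ => ρ) := by
        refine lintegral_mono fun w => ?_
        refine (hC _ _).trans (le_of_eq ?_)
        rw [ENNReal.mul_rpow_of_nonneg _ _ hr0.le, eLpNorm'_rpow hr0]
        simp_rw [hcomb]
    _ = (C : ℝ≥0∞) ^ r * eLpNorm' (fun y : (Fin n → ℂ) × (Fin (M + 1) → ℂ) =>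
          (linear x).eval (B y.2 * y.1)) r
            ((Measure.pi fun _ => ρ).prod (Measure.pi fun _ => rademacherLaw)) ^ r := by
        rw [lintegral_const_mul' _ _ (by finiteness), eLpNorm'_rpow hr0,
          lintegral_prod _ (hm.enorm.pow_const r).aemeasurable]
    _ ≤ _ := by
        rw [mul_assoc, ENNReal.mul_rpow_of_nonneg (C : ℝ≥0∞) _ hr0.le]
        gcongr

/-- Each of the M + 1 disjointified sums is at least half as large as the original one, while cotype
bounds the total of their r-th powers by a single full sum. -/
lemma multNorm_rpow_le [CompleteSpace X] (hr : 1 ≤ r) {C : ℝ≥0} (hC : ∀ (N : ℕ) (y : Fin N → X),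
      ∑ j, ‖y j‖ₑ ^ r ≤ (C * eLpNorm' (linear y).eval r (Measure.pi fun _ => rademacherLaw)) ^ r)
    {ρ ν : Measure ℂ} [IsProbabilityMeasure ρ] [IsProbabilityMeasure ν] (hρ : IsSymmetricLaw ρ)
    {a : ℂ → ℝ} (ha : Measurable a) (h0 : ∀ z, 0 ≤ a z) (h1 : ∀ z, a z ≤ 1) {M : ℕ}
    (hM : M * ∫ z, a z ∂ν ≤ 1 / 2) (x : Fin n → X) :
    ((M + 1 : ℕ) : ℝ≥0∞) * multNorm r ρ ν x (fun z => (a z : ℂ)) ^ r ≤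
      (2 * (C * contrConst 1 * eLpNorm' (linear x).eval r (Measure.pi fun _ => ρ))) ^ r := by
  have hr0 : 0 < r := zero_lt_one.trans_le hr
  set κ := Measure.pi fun _ : Fin (M + 1) => Measure.pi fun _ : Fin n => ν
  set π := Measure.pi fun _ : Fin n => ρ
  have hsm := fun j => (stronglyMeasurable_eval_hitMult (linear x) ha (M := M) j).enorm.pow_const r
  have hj : ∀ j : Fin (M + 1), multNorm r ρ ν x (fun z => (a z : ℂ)) ^ r ≤
      2 ^ r * ∫⁻ Z, ∫⁻ w, ‖(linear x).eval ((fun i => (hitMult a j Z i : ℂ)) * w)‖ₑ ^ r ∂π ∂κ := by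
    intro j
    refine (ENNReal.rpow_le_rpow (multNorm_le_eLpNorm'_hitMult hr ha h0 h1 hM x j) hr0.le).trans
      (le_of_eq ?_)
    rw [ENNReal.mul_rpow_of_nonneg _ _ hr0.le, eLpNorm'_rpow hr0,
      lintegral_prod_symm _ (hsm j).aemeasurable]
  calc ((M + 1 : ℕ) : ℝ≥0∞) * multNorm r ρ ν x (fun z => (a z : ℂ)) ^ r
      = ∑ _j : Fin (M + 1), multNorm r ρ ν x (fun z => (a z : ℂ)) ^ r := by simp
    _ ≤ ∑ j : Fin (M + 1), 2 ^ r *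
        ∫⁻ Z, ∫⁻ w, ‖(linear x).eval ((fun i => (hitMult a j Z i : ℂ)) * w)‖ₑ ^ r ∂π ∂κ :=
        Finset.sum_le_sum fun j _ => hj j
    _ = 2 ^ r * ∫⁻ Z, ∫⁻ w, ∑ j : Fin (M + 1),
        ‖(linear x).eval ((fun i => (hitMult a j Z i : ℂ)) * w)‖ₑ ^ r ∂π ∂κ := by
        rw [← Finset.mul_sum, ← lintegral_finsetSum]
        · congr 1
          refine lintegral_congr fun Z => ?_
          rw [lintegral_finsetSum]
          intro j _
          exact (stronglyMeasurable_eval_mul _ _).enorm.pow_const r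
        · intro j _
          exact (hsm j).lintegral_prod_left'
    _ ≤ 2 ^ r * ∫⁻ _, (C * contrConst 1 * eLpNorm' (linear x).eval r π) ^ r ∂κ := by
        gcongr with Z
        exact sum_lintegral_hitMult_le hr hC hρ h0 h1 x Z
    _ = _ := by
        rw [lintegral_const, measure_univ, mul_one, ENNReal.mul_rpow_of_nonneg 2 _ hr0.le]

/-- A selector of probability at most `τ` costs a factor of order `τ ^ (1 / r)`. -/
lemma multNorm_selector_le [CompleteSpace X] (hr : 1 ≤ r) {C : ℝ≥0} (hC : ∀ (N : ℕ) (y : Fin N → X),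
      ∑ j, ‖y j‖ₑ ^ r ≤ (C * eLpNorm' (linear y).eval r (Measure.pi fun _ => rademacherLaw)) ^ r)
    {ρ ν : Measure ℂ} [IsProbabilityMeasure ρ] [IsProbabilityMeasure ν] (hρ : IsSymmetricLaw ρ)
    {a : ℂ → ℝ} (ha : Measurable a) (h0 : ∀ z, 0 ≤ a z) (h1 : ∀ z, a z ≤ 1) {τ : ℝ} (hτ : 0 < τ)
    (haτ : ∫ z, a z ∂ν ≤ τ) (x : Fin n → X) :
    multNorm r ρ ν x (fun z => (a z : ℂ)) ≤ ENNReal.ofReal ((2 * τ) ^ (1 / r)) *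
      (2 * C * contrConst 1) * eLpNorm' (linear x).eval r (Measure.pi fun _ => ρ) := by
  have hr0 : 0 < r := zero_lt_one.trans_le hr
  -- The largest number of further copies with M τ ≤ 1/2; then M + 1 ≥ 1 / (2 τ), and the r-th root
  -- yields the factor (2 τ)^(1/r).
  set M := ⌊1 / (2 * τ)⌋₊ with hMdef
  have hM1 : (M : ℝ) ≤ 1 / (2 * τ) := Nat.floor_le (by positivity)
  have hM2 : 1 / (2 * τ) ≤ ((M + 1 : ℕ) : ℝ) := by push_cast; exact (Nat.lt_floor_add_one _).le
  have hM : M * ∫ z, a z ∂ν ≤ 1 / 2 := by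
    calc M * ∫ z, a z ∂ν ≤ 1 / (2 * τ) * τ := by
          gcongr
          exact integral_nonneg h0
      _ = 1 / 2 := by field_simp
  have h := multNorm_rpow_le hr hC hρ ha h0 h1 hM x
  rw [← ENNReal.rpow_le_rpow_iff hr0, mul_assoc, ENNReal.mul_rpow_of_nonneg _ _ hr0.le,
    ENNReal.ofReal_rpow_of_nonneg (by positivity) hr0.le, ← Real.rpow_mul (by positivity),
    one_div_mul_cancel hr0.ne', Real.rpow_one]
  have h2 : 1 ≤ ENNReal.ofReal (2 * τ) * ((M + 1 : ℕ) : ℝ≥0∞) := by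
    rw [← ENNReal.ofReal_natCast, ← ENNReal.ofReal_mul (by positivity), ENNReal.one_le_ofReal]
    calc (1 : ℝ) = 2 * τ * (1 / (2 * τ)) := by field_simp
      _ ≤ _ := by gcongr
  calc multNorm r ρ ν x (fun z => (a z : ℂ)) ^ r
      ≤ (ENNReal.ofReal (2 * τ) * ((M + 1 : ℕ) : ℝ≥0∞)) *
          multNorm r ρ ν x (fun z => (a z : ℂ)) ^ r := le_mul_of_one_le_left zero_le h2
    _ ≤ _ := by
        rw [mul_assoc]
        refine (mul_le_mul_right h _).trans (le_of_eq ?_)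
        congr 2
        ring

end Cotype

section LinearComparison

/-! ### Comparison of linear sums in spaces of non-trivial cotype -/

variable {X : Type*} [NormedAddCommGroup X] [NormedSpace ℂ X] {n : ℕ} {r : ℝ}

lemma multNorm_add_le (hr : 1 ≤ r) {ρ ν : Measure ℂ} (x : Fin n → X) {B B' : ℂ → ℂ}
    (hB : Measurable B) (hB' : Measurable B') :
    multNorm r ρ ν x (fun z => B z + B' z) ≤ multNorm r ρ ν x B + multNorm r ρ ν x B' := by
  refine le_trans (le_of_eq ?_) (eLpNorm'_add_le
    (stronglyMeasurable_eval_comp_mul _ hB).aestronglyMeasurable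
    (stronglyMeasurable_eval_comp_mul _ hB').aestronglyMeasurable hr)
  unfold multNorm
  congr 1
  ext y
  simp only [eval_linear, Pi.add_apply, Pi.mul_apply, ← Finset.sum_add_distrib, ← add_smul,
    ← add_mul]

lemma multNorm_const_mul_le (hr : 1 ≤ r) {ρ ν : Measure ℂ} (x : Fin n → X) (c : ℂ) (B : ℂ → ℂ) :
    multNorm r ρ ν x (fun z => c * B z) ≤ ‖c‖ₑ * multNorm r ρ ν x B := by
  refine le_trans (le_of_eq ?_) (eLpNorm'_const_smul_le (zero_lt_one.trans_le hr))
  unfold multNorm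
  congr 1
  ext y
  simp only [eval_linear, Pi.smul_apply, Pi.mul_apply, Finset.smul_sum, smul_smul, mul_assoc]

lemma multNorm_one {ρ ν : Measure ℂ} [IsProbabilityMeasure ρ] [IsProbabilityMeasure ν]
    (x : Fin n → X) :
    multNorm r ρ ν x (fun _ => 1) = eLpNorm' (linear x).eval r (Measure.pi fun _ => ρ) := by
  rw [← eLpNorm'_prod_fst (ν := Measure.pi fun _ : Fin n => ν) (linear x).stronglyMeasurable_eval]
  unfold multNorm
  congr 1
  ext y
  congr 1
  ext i
  simp

/-- The modulus, cut off at `2 ^ k`. -/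
def truncNorm (k : ℕ) (z : ℂ) : ℂ := if ‖z‖ < 2 ^ k then (‖z‖ : ℂ) else 0

/-- The modulus, restricted to the annulus `2 ^ k ≤ |z| < 2 ^ (k + 1)`. -/
def annulusNorm (k : ℕ) (z : ℂ) : ℂ := if 2 ^ k ≤ ‖z‖ ∧ ‖z‖ < 2 ^ (k + 1) then (‖z‖ : ℂ) else 0

/-- The indicator function of `|z| ≥ 2 ^ k`. -/
def outerInd (k : ℕ) : ℂ → ℝ := Set.indicator {z | (2 : ℝ) ^ k ≤ ‖z‖} 1

lemma measurable_truncNorm (k : ℕ) : Measurable (truncNorm k) :=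
  Measurable.ite (measurableSet_lt measurable_norm measurable_const)
    (Complex.measurable_ofReal.comp measurable_norm) measurable_const

lemma measurable_annulusNorm (k : ℕ) : Measurable (annulusNorm k) :=
  Measurable.ite ((measurableSet_le measurable_const measurable_norm).inter
    (measurableSet_lt measurable_norm measurable_const))
    (Complex.measurable_ofReal.comp measurable_norm) measurable_const

lemma measurableSet_outer (k : ℕ) : MeasurableSet {z : ℂ | (2 : ℝ) ^ k ≤ ‖z‖} :=
  measurableSet_le measurable_const measurable_norm

lemma measurable_outerInd (k : ℕ) : Measurable (outerInd k) :=
  measurable_one.indicator (measurableSet_outer k)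

lemma truncNorm_succ (k : ℕ) (z : ℂ) : truncNorm (k + 1) z = truncNorm k z + annulusNorm k z := by
  unfold truncNorm annulusNorm
  have h : (2 : ℝ) ^ k ≤ 2 ^ (k + 1) := pow_le_pow_right₀ (by norm_num) (Nat.le_succ k)
  by_cases h1 : ‖z‖ < 2 ^ k
  · simp [h1, h1.trans_le h, not_le.2 h1]
  · simp [h1, not_lt.1 h1]

lemma norm_annulusNorm_le (k : ℕ) (z : ℂ) :
    ‖annulusNorm k z‖ ≤ 1 * ‖((2 ^ (k + 1) : ℝ) : ℂ) * (outerInd k z : ℂ)‖ := by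
  unfold annulusNorm outerInd
  split_ifs with h
  · rw [Set.indicator_of_mem (by exact h.1)]
    simpa using h.2.le
  · simp

/-- The estimate for one annulus. -/
lemma multNorm_annulusNorm_le [CompleteSpace X] (hr : 1 ≤ r) {C : ℝ≥0}
    (hC : ∀ (N : ℕ) (y : Fin N → X), ∑ j, ‖y j‖ₑ ^ r ≤
      (C * eLpNorm' (linear y).eval r (Measure.pi fun _ => rademacherLaw)) ^ r)
    {ρ ν : Measure ℂ} [IsProbabilityMeasure ρ] [IsProbabilityMeasure ν] (hρ : IsSymmetricLaw ρ)
    {s M : ℝ} (hM : 0 < M) (htail : ∀ k, ∫ z, outerInd k z ∂ν ≤ M * 2 ^ (-(k * s))) (x : Fin n → X)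
    (k : ℕ) :
    multNorm r ρ ν x (annulusNorm k) ≤
      ((contrConst 1 * ENNReal.ofReal (2 * (2 * M) ^ (1 / r)) * (2 * C * contrConst 1)) *
        ENNReal.ofReal (2 ^ (1 - s / r)) ^ k) *
          eLpNorm' (linear x).eval r (Measure.pi fun _ => ρ) := by
  have hr0 : 0 < r := zero_lt_one.trans_le hr
  have h1 := multNorm_le_of_norm_le hr hρ (ν := ν) x (measurable_annulusNorm k)
    ((Complex.measurable_ofReal.comp (measurable_outerInd k)).const_mul ((2 ^ (k + 1) : ℝ) : ℂ))
    zero_lt_one (norm_annulusNorm_le k)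
  have h2 := multNorm_const_mul_le hr (ρ := ρ) (ν := ν) x ((2 ^ (k + 1) : ℝ) : ℂ)
    (fun z => (outerInd k z : ℂ))
  have h3 := multNorm_selector_le hr hC (ν := ν) hρ (measurable_outerInd k)
    (fun z => Set.indicator_nonneg (fun _ _ => zero_le_one) z)
    (fun z => Set.indicator_le_self' (f := (1 : ℂ → ℝ)) (fun _ _ => zero_le_one) z)
    (by positivity) (htail k) x
  refine h1.trans ?_
  refine (mul_le_mul_right (h2.trans (mul_le_mul_right h3 _)) _).trans (le_of_eq ?_)
  -- The height 2^(k+1) of the annulus against the selector gain 2^(-ks/r) leaves the geometric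
  -- ratio 2^(1 - s/r).
  have e : ‖((2 ^ (k + 1) : ℝ) : ℂ)‖ₑ * ENNReal.ofReal ((2 * (M * 2 ^ (-(k * s)))) ^ (1 / r)) =
      ENNReal.ofReal (2 * (2 * M) ^ (1 / r)) * ENNReal.ofReal (2 ^ (1 - s / r)) ^ k := by
    rw [← ofReal_norm, Complex.norm_real, Real.norm_of_nonneg (by positivity),
      ← ENNReal.ofReal_mul (by positivity), ← ENNReal.ofReal_pow (by positivity),
      ← ENNReal.ofReal_mul (by positivity)]
    congr 1
    rw [← mul_assoc, Real.mul_rpow (by positivity) (by positivity),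
      ← Real.rpow_mul (by norm_num), ← Real.rpow_natCast (2 ^ (1 - s / r)) k,
      ← Real.rpow_mul (by norm_num)]
    have : (2 : ℝ) ^ ((1 - s / r) * k) = 2 ^ k * 2 ^ (-(k * s) * (1 / r)) := by
      rw [← Real.rpow_natCast, ← Real.rpow_add (by norm_num)]
      congr 1
      ring
    rw [this, pow_succ]
    ring
  calc _ = contrConst 1 * (‖((2 ^ (k + 1) : ℝ) : ℂ)‖ₑ *
        ENNReal.ofReal ((2 * (M * 2 ^ (-(k * s)))) ^ (1 / r))) * (2 * C * contrConst 1) *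
          eLpNorm' (linear x).eval r (Measure.pi fun _ => ρ) := by ring
    _ = _ := by rw [e]; ring

/-- Markov's inequality for the s-th moment. The added 1 keeps the constant strictly positive. -/
lemma integral_outerInd_le {ν : Measure ℂ} [IsProbabilityMeasure ν] {s : ℝ} (hs0 : 0 < s)
    (hs : ∫⁻ z, ‖z‖ₑ ^ s ∂ν ≠ ∞) (k : ℕ) :
    ∫ z, outerInd k z ∂ν ≤ ((∫⁻ z, ‖z‖ₑ ^ s ∂ν).toReal + 1) * 2 ^ (-(k * s)) := by
  rw [outerInd, integral_indicator_one (measurableSet_outer k)]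
  have h := mul_meas_ge_le_lintegral (μ := ν) (f := fun z : ℂ => ‖z‖ₑ ^ s)
    (measurable_enorm.pow_const s) (ENNReal.ofReal (2 ^ (k * s)))
  have hset : {z : ℂ | ENNReal.ofReal (2 ^ (k * s)) ≤ ‖z‖ₑ ^ s} = {z : ℂ | (2 : ℝ) ^ k ≤ ‖z‖} := by
    ext z
    simp only [Set.mem_ofPred_eq]
    rw [← ofReal_norm, ENNReal.ofReal_rpow_of_nonneg (norm_nonneg _) hs0.le,
      ENNReal.ofReal_le_ofReal_iff (by positivity), Real.rpow_mul (by norm_num),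
      Real.rpow_le_rpow_iff (by positivity) (norm_nonneg _) hs0, Real.rpow_natCast]
  rw [hset] at h
  have h' := ENNReal.toReal_mono hs h
  rw [ENNReal.toReal_mul, ENNReal.toReal_ofReal (by positivity)] at h'
  rw [Real.rpow_neg (by norm_num), ← div_eq_mul_inv, le_div_iff₀ (by positivity), mul_comm]
  exact h'.trans (by linarith)

/-- The modulus cut off at 2^K is its part below 1, handled by contraction, plus the annuli of index
k < K. -/
lemma multNorm_truncNorm_le (hr : 1 ≤ r) {ρ ν : Measure ℂ}
    [IsProbabilityMeasure ρ] [IsProbabilityMeasure ν] (hρ : IsSymmetricLaw ρ) (x : Fin n → X)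
    {D t : ℝ≥0∞} (h : ∀ k, multNorm r ρ ν x (annulusNorm k) ≤
      D * t ^ k * eLpNorm' (linear x).eval r (Measure.pi fun _ => ρ)) (K : ℕ) :
    multNorm r ρ ν x (truncNorm K) ≤ (contrConst 1 + D * ∑ k ∈ Finset.range K, t ^ k) *
      eLpNorm' (linear x).eval r (Measure.pi fun _ => ρ) := by
  induction K with
  | zero =>
    have := multNorm_le_of_norm_le hr hρ (ν := ν) x (measurable_truncNorm 0)
      (measurable_const (a := (1 : ℂ))) zero_lt_one (fun z => by
        unfold truncNorm
        split_ifs with h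
        · simpa using h.le
        · simp)
    rw [multNorm_one] at this
    simpa using this
  | succ K ih =>
    have e : truncNorm (K + 1) = fun z => truncNorm K z + annulusNorm K z :=
      funext fun z => truncNorm_succ K z
    rw [e]
    refine (multNorm_add_le hr x (measurable_truncNorm K) (measurable_annulusNorm K)).trans ?_
    refine (add_le_add ih (h K)).trans (le_of_eq ?_)
    rw [Finset.sum_range_succ]
    ring

/-- Fatou's lemma: at each point the truncations are eventually equal to the modulus. -/
lemma multNorm_norm_le_of_truncNorm_le {ρ ν : Measure ℂ} (hr : 1 ≤ r) [IsProbabilityMeasure ρ]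
    [IsProbabilityMeasure ν] (x : Fin n → X) {L : ℝ≥0∞}
    (h : ∀ K, multNorm r ρ ν x (truncNorm K) ≤ L) :
    multNorm r ρ ν x (fun z => (‖z‖ : ℂ)) ≤ L := by
  refine (Lp.eLpNorm'_lim_le_liminf_eLpNorm' (f := fun K (y : (Fin n → ℂ) × (Fin n → ℂ)) =>
    (linear x).eval ((fun i => truncNorm K (y.2 i)) * y.1)) (zero_lt_one.trans_le hr)
    (fun K => (stronglyMeasurable_eval_comp_mul _ (measurable_truncNorm K)).aestronglyMeasurable)
    (Filter.Eventually.of_forall fun y => ?_)).trans ?_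
  · refine tendsto_const_nhds.congr' ?_
    have h1 : ∀ᶠ K : ℕ in Filter.atTop, ∀ i, ‖y.2 i‖ < 2 ^ K := by
      rw [Filter.eventually_all]
      exact fun i => (tendsto_pow_atTop_atTop_of_one_lt one_lt_two).eventually_gt_atTop _
    filter_upwards [h1] with K hK
    congr 2
    ext i
    simp [truncNorm, hK i]
  · exact Filter.liminf_le_of_frequently_le' (Filter.Frequently.of_forall h)

/-- Symmetry of ν allows unimodular factors wᵢ to be inserted; symmetry of ρ then allows zᵢ to be
replaced by |zᵢ|. -/
lemma eLpNorm'_linear_le_multNorm (hr : 1 ≤ r) {ρ ν : Measure ℂ} [IsProbabilityMeasure ρ]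
    [IsProbabilityMeasure ν] (hρ : IsSymmetricLaw ρ) (hρ1 : IsUnimodularLaw ρ)
    (hν : IsSymmetricLaw ν) (x : Fin n → X) :
    eLpNorm' (linear x).eval r (Measure.pi fun _ => ν) ≤
      (contrConst 1 * contrConst 1) * multNorm r ρ ν x (fun z => (‖z‖ : ℂ)) := by
  have hr0 : 0 < r := zero_lt_one.trans_le hr
  rw [← eLpNorm'_prod_snd (μ := Measure.pi fun _ : Fin n => ρ) (linear x).stronglyMeasurable_eval,
    mul_assoc]
  have h1 := multNorm_le_of_norm_le hr hρ (ν := ν) x measurable_id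
    (Complex.measurable_ofReal.comp measurable_norm) zero_lt_one (fun z => by simp)
  refine le_trans ?_ (mul_le_mul_right h1 _)
  refine eLpNorm'_prod_le_of_ae_section_le hr0
    ((linear x).stronglyMeasurable_eval.comp_measurable measurable_snd)
    (stronglyMeasurable_eval_comp_mul _ measurable_id) ENNReal.coe_ne_top ?_
  filter_upwards [ae_pi_of_ae hρ1] with w hw
  have := eLpNorm'_eval_mul_le_of_norm_le hr hν (linear x) (card_le_one_of_linear x) zero_lt_one
    (z := 1) (y := w) (fun i => by simp [hw i])
  simp only [one_mul, pow_one, mul_comm w] at this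
  exact this

/-- In a space of cotype `q ≤ r < s`, symmetric variables with a finite `s`-th moment are
dominated by Steinhaus variables. -/
lemma HasCotype.exists_linear_le [CompleteSpace X] {q s : ℝ} (hcot : HasCotype X q) (hqr : q ≤ r)
    (hrs : r < s) {ν : Measure ℂ} [IsProbabilityMeasure ν] (hν : IsSymmetricLaw ν)
    (hs : ∫⁻ z, ‖z‖ₑ ^ s ∂ν ≠ ∞) :
    ∃ K : ℝ≥0, 1 ≤ K ∧ ∀ (n : ℕ) (x : Fin n → X),
      eLpNorm' (linear x).eval r (Measure.pi fun _ => ν) ≤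
        K * eLpNorm' (linear x).eval r (Measure.pi fun _ => steinhausLaw) := by
  have hr : 1 ≤ r := by linarith [hcot.1]
  have hr0 : 0 < r := by linarith
  obtain ⟨C, -, hC⟩ := hcot.exists_sum_enorm_rpow_le hqr
  set M : ℝ := (∫⁻ z, ‖z‖ₑ ^ s ∂ν).toReal + 1 with hM
  set D : ℝ≥0∞ := contrConst 1 * ENNReal.ofReal (2 * (2 * M) ^ (1 / r)) * (2 * C * contrConst 1)
  set t : ℝ≥0∞ := ENNReal.ofReal (2 ^ (1 - s / r)) with ht
  have ht1 : t < 1 := by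
    rw [ht, ENNReal.ofReal_lt_one]
    refine Real.rpow_lt_one_of_one_lt_of_neg one_lt_two ?_
    rw [sub_neg, one_lt_div hr0]
    exact hrs
  set L : ℝ≥0∞ := (contrConst 1 * contrConst 1) * (contrConst 1 + D * (1 - t)⁻¹) with hL
  have hLtop : L ≠ ∞ := by
    have : (1 - t)⁻¹ ≠ ∞ := by
      rw [ENNReal.inv_ne_top]; exact (tsub_pos_of_lt ht1).ne'
    have hD : D ≠ ∞ := by finiteness
    finiteness
  refine ⟨L.toNNReal + 1, le_add_self, fun n x => ?_⟩
  have h1 := fun k => multNorm_annulusNorm_le hr hC (ν := ν) isSymmetricLaw_steinhausLaw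
    (by positivity : 0 < M) (integral_outerInd_le (by linarith) hs) x k
  have h2 := multNorm_norm_le_of_truncNorm_le (ρ := steinhausLaw) (ν := ν) hr x
    (L := (contrConst 1 + D * (1 - t)⁻¹) *
      eLpNorm' (linear x).eval r (Measure.pi fun _ => steinhausLaw))
    (fun K => (multNorm_truncNorm_le hr isSymmetricLaw_steinhausLaw x h1 K).trans (by
      gcongr
      rw [← ENNReal.tsum_geometric]
      exact ENNReal.sum_le_tsum _))
  have h3 := eLpNorm'_linear_le_multNorm hr isSymmetricLaw_steinhausLaw
    isUnimodularLaw_steinhausLaw hν x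
  refine h3.trans ((mul_le_mul_right h2 _).trans ?_)
  rw [← mul_assoc, ← hL]
  gcongr
  rw [ENNReal.coe_add, ENNReal.coe_toNNReal hLtop]
  exact le_self_add

/-- The comparison of linear sums in `L_p`, for all `p < s`. -/
lemma exists_linear_le_of_cot_lt [CompleteSpace X] {p s : ℝ} (hcot : HasNontrivialCotype X)
    (hXs : cot X < s) (hp : 1 ≤ p) (hps : p < s) {ν : Measure ℂ} [IsProbabilityMeasure ν]
    (hν : IsSymmetricLaw ν) (hs : ∫⁻ z, ‖z‖ₑ ^ s ∂ν ≠ ∞) :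
    ∃ K : ℝ≥0, 1 ≤ K ∧ ∀ (n : ℕ) (x : Fin n → X),
      eLpNorm' (linear x).eval p (Measure.pi fun _ => ν) ≤
        K * eLpNorm' (linear x).eval p (Measure.pi fun _ => steinhausLaw) := by
  obtain ⟨q, hq, hqs⟩ := exists_lt_of_csInf_lt (s := {q : ℝ | HasCotype X q}) hcot hXs
  -- The exponent r = max q p satisfies q ≤ r < s, as cotype requires, and r ≥ p; Kahane's
  -- inequality then descends from r to p on the Steinhaus side.
  obtain ⟨K, hK1, hK⟩ := hq.exists_linear_le (le_max_left q p) (max_lt hqs hps) hν hs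
  obtain ⟨K', hK1', hK'⟩ := kahane_steinhaus (X := X) (hq.1.trans (le_max_left q p)) hp
  refine ⟨K * K', one_le_mul hK1 hK1', fun n x => ?_⟩
  refine (eLpNorm'_le_eLpNorm'_of_exponent_le (zero_lt_one.trans_le hp) (le_max_right q p) _
    (linear x).stronglyMeasurable_eval.aestronglyMeasurable).trans ((hK n x).trans ?_)
  rw [ENNReal.coe_mul, mul_assoc]
  exact mul_le_mul_right (hK' n x) _

end LinearComparison

section Homogeneous

variable {X : Type*} [NormedAddCommGroup X] [NormedSpace ℂ X] {n : ℕ} {p : ℝ}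

/-! ### Homogeneous parts -/

lemma eval_eq_sum_of_coeff {ι : Type*} {P Q : TetrahedralPolynomial n X} (s : Finset ι) (c : ι → ℂ)
    (y : ι → Fin n → ℂ) (h : ∀ A, Q A = (∑ j ∈ s, c j * ∏ k ∈ A, y j k) • P A) (u : Fin n → ℂ) :
    Q.eval u = ∑ j ∈ s, c j • P.eval (y j * u) := by
  simp only [eval, Finset.smul_sum]
  rw [Finset.sum_comm]
  refine Finset.sum_congr rfl fun A _ => ?_
  simp only [h A, Pi.mul_apply, Finset.prod_mul_distrib, smul_smul, ← Finset.sum_smul,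
    Finset.mul_sum]
  congr 1
  exact Finset.sum_congr rfl fun j _ => by ring

/-- The homogeneous part of degree `k`. -/
def TetrahedralPolynomial.homPart {X : Type*} [NormedAddCommGroup X] (k : ℕ)
    (P : TetrahedralPolynomial n X) : TetrahedralPolynomial n X :=
  fun A => if A.card = k then P A else 0

lemma eval_eq_sum_homPart (P : TetrahedralPolynomial n X) {m : ℕ}
    (hP : ∀ A, P A ≠ 0 → A.card ≤ m) (u : Fin n → ℂ) :
    P.eval u = ∑ k ∈ Finset.range (m + 1), (P.homPart k).eval u := by
  simp only [eval]
  rw [Finset.sum_comm]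
  refine Finset.sum_congr rfl fun A _ => ?_
  rw [← Finset.smul_sum]
  congr 1
  by_cases hA : P A = 0
  · simp [homPart, hA]
  · simp [homPart, hP A hA]

/-- Orthogonality of characters; m + 1 roots are needed to separate the degrees 0, …, m. -/
lemma sum_rootsOfUnity {m k l : ℕ} (hk : k ≤ m) (hl : l ≤ m) {ζ : ℂ}
    (hζ : IsPrimitiveRoot ζ (m + 1)) :
    ∑ j ∈ Finset.range (m + 1), ((m + 1 : ℂ)⁻¹ * (ζ ^ k)⁻¹ ^ j) * (ζ ^ j) ^ l =
      if l = k then 1 else 0 := by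
  have hζ0 : ζ ≠ 0 := hζ.ne_zero (by omega)
  have h1 : ∀ j, ((m + 1 : ℂ)⁻¹ * (ζ ^ k)⁻¹ ^ j) * (ζ ^ j) ^ l =
      (m + 1 : ℂ)⁻¹ * (ζ ^ l * (ζ ^ k)⁻¹) ^ j := by
    intro j
    rw [mul_pow, ← pow_mul ζ j l, ← pow_mul ζ l j, mul_comm j l]
    ring
  simp_rw [h1]
  rw [← Finset.mul_sum]
  have hm : (m + 1 : ℂ) ≠ 0 := by exact_mod_cast Nat.succ_ne_zero m
  split_ifs with h
  · subst h
    rw [mul_inv_cancel₀ (pow_ne_zero _ hζ0)]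
    simp [hm]
  · have hne : ζ ^ l * (ζ ^ k)⁻¹ ≠ 1 := by
      rw [Ne, mul_inv_eq_one₀ (pow_ne_zero _ hζ0)]
      intro h'
      exact h (hζ.pow_inj (by omega) (by omega) h')
    rw [geom_sum_eq hne, mul_pow, ← pow_mul, inv_pow, ← pow_mul, mul_comm l, mul_comm k, pow_mul,
      pow_mul, hζ.pow_eq_one]
    simp

/-- Passing to a homogeneous part. -/
lemma eLpNorm'_homPart_le (hp : 1 ≤ p) {ρ : Measure ℂ} [IsProbabilityMeasure ρ]
    (hρ : IsSymmetricLaw ρ) (P : TetrahedralPolynomial n X) {m : ℕ}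
    (hP : ∀ A, P A ≠ 0 → A.card ≤ m) {k : ℕ} (hk : k ≤ m) :
    eLpNorm' (P.homPart k).eval p (Measure.pi fun _ => ρ) ≤
      (contrConst 1 : ℝ≥0∞) ^ m * eLpNorm' P.eval p (Measure.pi fun _ => ρ) := by
  obtain ⟨ζ, hζ⟩ : ∃ ζ : ℂ, IsPrimitiveRoot ζ (m + 1) :=
    ⟨_, Complex.isPrimitiveRoot_exp (m + 1) (Nat.succ_ne_zero m)⟩
  have hζ1 : ‖ζ‖ = 1 := hζ.norm'_eq_one (Nat.succ_ne_zero m)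
  have h : (P.homPart k).eval = fun u => ∑ j ∈ Finset.range (m + 1),
      ((m + 1 : ℂ)⁻¹ * (ζ ^ k)⁻¹ ^ j) • P.eval ((fun _ => ζ ^ j) * u) := by
    ext u
    refine eval_eq_sum_of_coeff _ _ (fun j _ => ζ ^ j) (fun A => ?_) u
    by_cases hA : P A = 0
    · simp [homPart, hA]
    · simp only [Finset.prod_const, sum_rootsOfUnity hk (hP A hA) hζ, homPart]
      split_ifs <;> simp
  rw [h]
  -- A rotation by ζ^j need not preserve ρ, hence the contraction principle. The m + 1 coefficients
  -- have modulus 1 / (m + 1), so averaging costs nothing more.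
  refine (eLpNorm'_sum_smul_le hp _ _
    (fun j _ => (stronglyMeasurable_eval_mul P _).aestronglyMeasurable)
    (fun j _ => eLpNorm'_eval_mul_le hp hρ P hP zero_lt_one (fun i => by simp [hζ1]))).trans ?_
  refine mul_le_of_le_one_left zero_le (le_of_eq ?_)
  have hn : ∀ j, ‖(m + 1 : ℂ)⁻¹ * (ζ ^ k)⁻¹ ^ j‖ₑ = ((m + 1 : ℕ) : ℝ≥0∞)⁻¹ := by
    intro j
    rw [← ofReal_norm, norm_mul, norm_inv, norm_pow, norm_inv, norm_pow, hζ1]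
    have : ‖(m + 1 : ℂ)‖ = ((m + 1 : ℕ) : ℝ) := by
      rw [← Complex.norm_natCast]; push_cast; rfl
    rw [this, one_pow, inv_one, one_pow, mul_one, ENNReal.ofReal_inv_of_pos (by positivity),
      ENNReal.ofReal_natCast]
  simp_rw [hn]
  rw [Finset.sum_const, Finset.card_range, nsmul_eq_mul]
  exact ENNReal.mul_inv_cancel (by simp) (by finiteness)

/-! ### Rainbow parts of homogeneous polynomials -/

/-- The part of `P` that consists of the monomials with `k` variables of `k` different colours,
for a colouring `c` of the variables by `k` colours. -/
def TetrahedralPolynomial.rainbow {X : Type*} [NormedAddCommGroup X] {k : ℕ} (c : Fin n → Fin k)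
    (P : TetrahedralPolynomial n X) : TetrahedralPolynomial n X :=
  open Classical in fun A => if A.card = k ∧ Set.InjOn c A then P A else 0

-- Such a colouring is a bijection from A onto the k colours together with arbitrary colours off A.
open Classical in
lemma card_injOn_colourings {k : ℕ} (A : Finset (Fin n)) (hA : A.card = k) :
    (Finset.univ.filter fun c : Fin n → Fin k => Set.InjOn c A).card =
      k.factorial * k ^ (n - k) := by
  rw [← Fintype.card_subtype]
  let e : {c : Fin n → Fin k // Set.InjOn c A} ≃
      ({i // i ∈ A} ↪ Fin k) × ({i // i ∉ A} → Fin k) :=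
    ((Equiv.piEquivPiSubtypeProd (fun i => i ∈ A) fun _ => Fin k).subtypeEquiv
      (q := fun fg => Function.Injective fg.1) (fun c => by
        simp only [Equiv.piEquivPiSubtypeProd_apply]
        rw [Set.injOn_iff_injective]
        rfl)).trans
    ((Equiv.prodSubtypeFstEquivSubtypeProd (p := fun f : {i // i ∈ A} → Fin k =>
      Function.Injective f)).trans
      ((Equiv.subtypeInjectiveEquivEmbedding _ _).prodCongr (Equiv.refl _)))
  rw [Fintype.card_congr e, Fintype.card_prod, Fintype.card_embedding_eq, Fintype.card_fun,
    Fintype.card_fin, Fintype.card_coe, hA, Nat.descFactorial_self]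
  congr 2
  rw [Fintype.card_subtype_compl]
  simp [hA]

/-- Every monomial of degree k is rainbow for the same number of colourings, so summing over all
colourings counts each one equally often. -/
lemma eval_eq_sum_rainbow {k : ℕ} (P : TetrahedralPolynomial n X)
    (hP : ∀ A, P A ≠ 0 → A.card = k) (hk : k ≠ 0) (u : Fin n → ℂ) :
    P.eval u = ∑ c : Fin n → Fin k,
      ((k.factorial * k ^ (n - k) : ℕ) : ℂ)⁻¹ • (P.rainbow c).eval u := by
  classical
  have hne : ((k.factorial * k ^ (n - k) : ℕ) : ℂ) ≠ 0 := by
    have : k.factorial * k ^ (n - k) ≠ 0 :=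
      mul_ne_zero (Nat.factorial_ne_zero k) (pow_ne_zero _ hk)
    exact_mod_cast this
  rw [← Finset.smul_sum]
  simp only [eval]
  rw [Finset.sum_comm, Finset.smul_sum]
  refine Finset.sum_congr rfl fun A _ => ?_
  rw [← Finset.smul_sum, smul_comm]
  congr 1
  by_cases hA : P A = 0
  · simp [rainbow, hA]
  · have hAk := hP A hA
    simp only [rainbow, hAk, true_and]
    rw [← Finset.sum_filter, Finset.sum_const, card_injOn_colourings A hAk,
      ← Nat.cast_smul_eq_nsmul ℂ, smul_smul, inv_mul_cancel₀ hne, one_smul]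

lemma image_eq_univ_of_injOn {k : ℕ} {c : Fin n → Fin k} {A : Finset (Fin n)} (hA : A.card = k)
    (hc : Set.InjOn c A) : A.image c = Finset.univ := by
  rw [← Finset.card_eq_iff_eq_univ, Finset.card_image_of_injOn hc, hA, Fintype.card_fin]

-- One sign per colour: the exponent of θ j is 1 plus the number of elements of A of colour j. If A
-- is rainbow, all exponents are 2; otherwise, as |A| = k, some colour is missed, its exponent is 1,
-- and the average vanishes.
open Classical in
lemma sum_signs_rainbow {k : ℕ} (c : Fin n → Fin k) (A : Finset (Fin n)) (hA : A.card = k) :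
    ∑ θ : Fin k → ℤˣ, ((2 ^ k : ℂ)⁻¹ * ∏ j, ((θ j : ℤ) : ℂ)) * ∏ i ∈ A, ((θ (c i) : ℤ) : ℂ) =
      if Set.InjOn c A then 1 else 0 := by
  have h1 : ∀ θ : Fin k → ℤˣ,
      ((2 ^ k : ℂ)⁻¹ * ∏ j, ((θ j : ℤ) : ℂ)) * ∏ i ∈ A, ((θ (c i) : ℤ) : ℂ) =
      (2 ^ k : ℂ)⁻¹ * ∏ j, ((θ j : ℤ) : ℂ) ^ (1 + (A.filter fun i => c i = j).card) := by
    intro θ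
    have : ∏ i ∈ A, ((θ (c i) : ℤ) : ℂ) =
        ∏ j, ((θ j : ℤ) : ℂ) ^ (A.filter fun i => c i = j).card := by
      rw [← Finset.prod_fiberwise A c]
      refine Finset.prod_congr rfl fun j _ => ?_
      rw [← Finset.prod_const]
      exact Finset.prod_congr rfl fun i hi => by rw [(Finset.mem_filter.1 hi).2]
    rw [this, mul_assoc, ← Finset.prod_mul_distrib]
    simp only [pow_add, pow_one]
  simp_rw [h1]
  rw [← Finset.mul_sum, ← Fintype.prod_sum (fun j (e : ℤˣ) =>
    ((e : ℤ) : ℂ) ^ (1 + (A.filter fun i => c i = j).card))]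
  simp_rw [sum_units_int]
  split_ifs with h
  · have himg := image_eq_univ_of_injOn hA h
    have hone : ∀ j, (A.filter fun i => c i = j).card = 1 := by
      intro j
      have hj : j ∈ A.image c := by rw [himg]; exact Finset.mem_univ j
      obtain ⟨i, hi, hij⟩ := Finset.mem_image.1 hj
      rw [Finset.card_eq_one]
      refine ⟨i, Finset.ext fun l => ?_⟩
      simp only [Finset.mem_filter, Finset.mem_singleton]
      exact ⟨fun hl => h hl.1 hi (hl.2.trans hij.symm), fun hl => hl ▸ ⟨hi, hij⟩⟩
    simp only [hone]
    norm_num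
  · have himg : A.image c ≠ Finset.univ := by
      intro h'
      refine h (Finset.card_image_iff.1 ?_)
      rw [h', Finset.card_univ, Fintype.card_fin, hA]
    obtain ⟨j, hj⟩ : ∃ j, j ∉ A.image c := by
      by_contra h'
      push Not at h'
      exact himg (Finset.eq_univ_of_forall h')
    have hzero : (A.filter fun i => c i = j).card = 0 := by
      rw [Finset.card_eq_zero, Finset.filter_eq_empty_iff]
      exact fun i hi hij => hj (Finset.mem_image.2 ⟨i, hi, hij⟩)
    rw [Finset.prod_eq_zero (Finset.mem_univ j) (by simp [hzero]), mul_zero]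

/-- Passing to the rainbow part of a homogeneous polynomial. -/
lemma eLpNorm'_rainbow_le (hp : 1 ≤ p) {ρ : Measure ℂ} [IsProbabilityMeasure ρ]
    (hρ : IsSymmetricLaw ρ) {k : ℕ} (P : TetrahedralPolynomial n X)
    (hP : ∀ A, P A ≠ 0 → A.card = k) (c : Fin n → Fin k) :
    eLpNorm' (P.rainbow c).eval p (Measure.pi fun _ => ρ) ≤
      eLpNorm' P.eval p (Measure.pi fun _ => ρ) := by
  classical
  have h : (P.rainbow c).eval = fun u => ∑ θ : Fin k → ℤˣ,
      ((2 ^ k : ℂ)⁻¹ * ∏ j, ((θ j : ℤ) : ℂ)) • P.eval ((fun i => ((θ (c i) : ℤ) : ℂ)) * u) := by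
    ext u
    refine eval_eq_sum_of_coeff Finset.univ
      (fun θ : Fin k → ℤˣ => (2 ^ k : ℂ)⁻¹ * ∏ j, ((θ j : ℤ) : ℂ))
      (fun (θ : Fin k → ℤˣ) i => ((θ (c i) : ℤ) : ℂ)) (fun A => ?_) u
    by_cases hA : P A = 0
    · simp [rainbow, hA]
    · rw [sum_signs_rainbow c A (hP A hA)]
      simp [rainbow, hP A hA]
  rw [h]
  refine (eLpNorm'_sum_smul_le hp Finset.univ
    (fun θ : Fin k → ℤˣ => (2 ^ k : ℂ)⁻¹ * ∏ j, ((θ j : ℤ) : ℂ))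
    (f := fun (θ : Fin k → ℤˣ) u => P.eval ((fun i => ((θ (c i) : ℤ) : ℂ)) * u))
    (fun θ _ => (stronglyMeasurable_eval_mul P _).aestronglyMeasurable)
    (fun θ _ => (eLpNorm'_eval_sign_mul hρ P fun i => θ (c i)).le)).trans ?_
  refine mul_le_of_le_one_left zero_le (le_of_eq ?_)
  have hn : ∀ θ : Fin k → ℤˣ, ‖(2 ^ k : ℂ)⁻¹ * ∏ j, ((θ j : ℤ) : ℂ)‖ₑ = ((2 ^ k : ℕ) : ℝ≥0∞)⁻¹ := by
    intro θ
    have h1 : ‖∏ j, ((θ j : ℤ) : ℂ)‖ = 1 := by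
      rw [norm_prod]
      refine Finset.prod_eq_one fun j _ => ?_
      rcases Int.units_eq_one_or (θ j) with h | h <;> simp [h]
    rw [← ofReal_norm, norm_mul, h1, mul_one, norm_inv, norm_pow, Complex.norm_ofNat,
      ENNReal.ofReal_inv_of_pos (by positivity), ← ENNReal.ofReal_natCast]
    push_cast
    rfl
  simp_rw [hn]
  rw [Finset.sum_const, Finset.card_univ, Fintype.card_fun, Fintype.card_fin,
    Fintype.card_units_int, nsmul_eq_mul]
  exact ENNReal.mul_inv_cancel (by simp) (by finiteness)

/-! ### Replacing the variables block by block -/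

lemma measurePreserving_mix (α β : Fin n → Measure ℂ) [∀ i, IsProbabilityMeasure (α i)]
    [∀ i, IsProbabilityMeasure (β i)] (B : Fin n → Prop) [DecidablePred B] :
    MeasurePreserving (fun (z : (Fin n → ℂ) × (Fin n → ℂ)) i => if B i then z.2 i else z.1 i)
      ((Measure.pi α).prod (Measure.pi β)) (Measure.pi fun i => if B i then β i else α i) := by
  have hm : Measurable fun (z : (Fin n → ℂ) × (Fin n → ℂ)) i => if B i then z.2 i else z.1 i := by
    refine measurable_pi_lambda _ fun i => ?_
    split_ifs <;> fun_prop
  have : ∀ i, IsProbabilityMeasure (if B i then β i else α i) := fun i => by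
    split_ifs <;> infer_instance
  refine ⟨hm, (Measure.pi_eq fun s hs => ?_).symm⟩
  rw [Measure.map_apply hm (MeasurableSet.univ_pi hs)]
  have hpre : (fun (z : (Fin n → ℂ) × (Fin n → ℂ)) i => if B i then z.2 i else z.1 i) ⁻¹'
      Set.univ.pi s = (Set.univ.pi fun i => if B i then Set.univ else s i) ×ˢ
        (Set.univ.pi fun i => if B i then s i else Set.univ) := by
    ext z
    simp only [Set.mem_preimage, Set.mem_univ_pi, Set.mem_prod, ← forall_and]
    refine forall_congr' fun i => ?_
    split_ifs <;> simp
  rw [hpre, Measure.prod_prod, Measure.pi_pi, Measure.pi_pi, ← Finset.prod_mul_distrib]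
  refine Finset.prod_congr rfl fun i _ => ?_
  split_ifs <;> simp

/-- A rainbow monomial uses each of the k colours exactly once, so it contains exactly one variable
of colour j. -/
lemma eval_mix_eq_linear {k : ℕ} {c : Fin n → Fin k} {Q : TetrahedralPolynomial n X}
    (hQ : ∀ A, Q A ≠ 0 → A.card = k ∧ Set.InjOn c A) (j : Fin k) (z z' : Fin n → ℂ) :
    Q.eval (fun i => if c i = j then z' i else z i) =
      (linear fun i => if c i = j then
        ∑ A : Finset (Fin n), if i ∈ A then (∏ l ∈ A.erase i, z l) • Q A else 0
        else 0).eval z' := by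
  rw [eval_linear]
  have h1 : ∀ i, (z' i • if c i = j then
        ∑ A : Finset (Fin n), if i ∈ A then (∏ l ∈ A.erase i, z l) • Q A else 0 else 0) =
      ∑ A : Finset (Fin n), if c i = j ∧ i ∈ A then (z' i * ∏ l ∈ A.erase i, z l) • Q A else 0 := by
    intro i
    by_cases h : c i = j
    · simp [h, Finset.smul_sum, smul_smul]
    · simp [h]
  simp_rw [h1]
  rw [Finset.sum_comm, eval]
  refine Finset.sum_congr rfl fun A _ => ?_
  by_cases hA : Q A = 0
  · simp [hA]
  · obtain ⟨hcard, hinj⟩ := hQ A hA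
    have hj : j ∈ A.image c := by
      rw [image_eq_univ_of_injOn hcard hinj]; exact Finset.mem_univ j
    obtain ⟨i, hi, hij⟩ := Finset.mem_image.1 hj
    rw [Finset.sum_eq_single i, if_pos ⟨hij, hi⟩, ← Finset.mul_prod_erase A _ hi, if_pos hij]
    · congr 2
      refine Finset.prod_congr rfl fun l hl => if_neg fun hlj => ?_
      obtain ⟨hli, hlA⟩ := Finset.mem_erase.1 hl
      exact hli (hinj hlA hi (hlj.trans hij.symm))
    · intro l _ hli
      refine if_neg fun hl => hli (hinj hl.2 hi (hl.1.trans hij.symm))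
    · exact fun h => absurd (Finset.mem_univ i) h

/-- Replacing the law `ν` by `ρ` in all variables whose colour is in `J`. -/
lemma eLpNorm'_rainbow_le_hybrid (hp : 1 ≤ p) {ρ ν : Measure ℂ} [IsProbabilityMeasure ρ]
    [IsProbabilityMeasure ν] {K : ℝ≥0} (hK : ∀ (n : ℕ) (x : Fin n → X),
      eLpNorm' (linear x).eval p (Measure.pi fun _ => ν) ≤
        K * eLpNorm' (linear x).eval p (Measure.pi fun _ => ρ))
    {k : ℕ} {c : Fin n → Fin k} {Q : TetrahedralPolynomial n X}
    (hQ : ∀ A, Q A ≠ 0 → A.card = k ∧ Set.InjOn c A) (J : Finset (Fin k)) :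
    eLpNorm' Q.eval p (Measure.pi fun _ => ν) ≤
      (K : ℝ≥0∞) ^ J.card * eLpNorm' Q.eval p (Measure.pi fun i => if c i ∈ J then ρ else ν) := by
  have hp0 : 0 < p := zero_lt_one.trans_le hp
  induction J using Finset.induction_on with
  | empty => simp
  | insert j J hj ih =>
    have hprob : ∀ i, IsProbabilityMeasure (if c i ∈ J then ρ else ν) := fun i => by
      split_ifs <;> infer_instance
    have m1 := measurePreserving_mix (fun i => if c i ∈ J then ρ else ν) (fun _ => ν)
      (fun i => c i = j)
    have m2 := measurePreserving_mix (fun i => if c i ∈ J then ρ else ν) (fun _ => ρ)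
      (fun i => c i = j)
    have e1 : (fun i => if c i = j then ν else if c i ∈ J then ρ else ν) =
        fun i => if c i ∈ J then ρ else ν := by
      ext1 i
      by_cases h : c i = j
      · simp [h, hj]
      · simp [h]
    have e2 : (fun i => if c i = j then ρ else if c i ∈ J then ρ else ν) =
        fun i => if c i ∈ insert j J then ρ else ν := by
      ext1 i
      by_cases h : c i = j
      · simp [h]
      · simp [h]
    rw [e1] at m1
    rw [e2] at m2
    have n1 := eLpNorm'_comp_measurePreserving (p := p) m1 Q.stronglyMeasurable_eval
    have n2 := eLpNorm'_comp_measurePreserving (p := p) m2 Q.stronglyMeasurable_eval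
    refine ih.trans ?_
    rw [Finset.card_insert_of_notMem hj, pow_succ, mul_assoc]
    refine mul_le_mul_right ?_ _
    rw [← n1, ← n2]
    -- With the variables of the other colours frozen, only a linear sum in colour j remains, so the
    -- linear comparison costs one factor K.
    refine eLpNorm'_prod_le_of_ae_section_le hp0
      (Q.stronglyMeasurable_eval.comp_measurable m1.measurable)
      (Q.stronglyMeasurable_eval.comp_measurable m2.measurable) ENNReal.coe_ne_top
      (Filter.Eventually.of_forall fun z => ?_)
    simp only [Function.comp_def, eval_mix_eq_linear hQ]
    exact hK n _

/-- There are k^n colourings, each of weight 1 / (k! k^(n-k)), so the total weight is k^k / k! ≤ e^k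
≤ 3^k; each rainbow part costs K^k. -/
lemma eLpNorm'_homogeneous_le (hp : 1 ≤ p) {ρ ν : Measure ℂ} [IsProbabilityMeasure ρ]
    [IsProbabilityMeasure ν] (hρ : IsSymmetricLaw ρ) {K : ℝ≥0}
    (hK : ∀ (n : ℕ) (x : Fin n → X), eLpNorm' (linear x).eval p (Measure.pi fun _ => ν) ≤
        K * eLpNorm' (linear x).eval p (Measure.pi fun _ => ρ))
    {k : ℕ} (P : TetrahedralPolynomial n X) (hP : ∀ A, P A ≠ 0 → A.card = k) :
    eLpNorm' P.eval p (Measure.pi fun _ => ν) ≤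
      ((3 * K : ℝ≥0) : ℝ≥0∞) ^ k * eLpNorm' P.eval p (Measure.pi fun _ => ρ) := by
  have hp0 : 0 < p := zero_lt_one.trans_le hp
  rcases Nat.eq_zero_or_pos k with rfl | hk
  · have hconst : P.eval = fun _ => P ∅ := by
      ext u
      rw [eval, Finset.sum_eq_single ∅]
      · simp
      · intro A _ hA
        have : P A = 0 := by
          by_contra h
          exact hA (Finset.card_eq_zero.1 (hP A h))
        simp [this]
      · simp
    rw [hconst, eLpNorm'_const_of_isProbabilityMeasure _ hp0,
      eLpNorm'_const_of_isProbabilityMeasure _ hp0]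
    simp
  -- For k > n the polynomial vanishes; the remaining case needs n - k to be a genuine subtraction.
  by_cases hkn : k ≤ n
  swap
  · have hzero : P.eval = 0 := by
      ext u
      refine Finset.sum_eq_zero fun A _ => ?_
      have : P A = 0 := by
        by_contra h
        have := A.card_le_univ
        rw [Fintype.card_fin, hP A h] at this
        exact hkn this
      simp [this]
    rw [hzero, eLpNorm'_zero hp0]
    exact zero_le
  have h : P.eval = fun u => ∑ c : Fin n → Fin k,
      ((k.factorial * k ^ (n - k) : ℕ) : ℂ)⁻¹ • (P.rainbow c).eval u := by
    ext u; exact eval_eq_sum_rainbow P hP hk.ne' u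
  have hc : ∀ c : Fin n → Fin k, eLpNorm' (P.rainbow c).eval p (Measure.pi fun _ => ν) ≤
      (K : ℝ≥0∞) ^ k * eLpNorm' P.eval p (Measure.pi fun _ => ρ) := by
    intro c
    have h1 := eLpNorm'_rainbow_le_hybrid hp hK (c := c) (Q := P.rainbow c) (fun A hA => by
      by_contra h
      exact hA (if_neg h)) Finset.univ
    simp only [Finset.card_univ, Fintype.card_fin, Finset.mem_univ, if_true] at h1
    exact h1.trans (mul_le_mul_right (eLpNorm'_rainbow_le hp hρ P hP c) _)
  conv_lhs => rw [h]
  refine (eLpNorm'_sum_smul_le hp Finset.univ _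
    (fun c _ => (P.rainbow c).stronglyMeasurable_eval.aestronglyMeasurable)
    (fun c _ => hc c)).trans ?_
  rw [ENNReal.coe_mul, mul_pow, mul_assoc]
  gcongr
  rw [Finset.sum_const, Finset.card_univ, Fintype.card_fun, Fintype.card_fin, Fintype.card_fin,
    nsmul_eq_mul, ← ofReal_norm, norm_inv, Complex.norm_natCast, ← ENNReal.ofReal_natCast,
    ← ENNReal.ofReal_mul (by positivity)]
  have h3 : ((3 : ℝ≥0) : ℝ≥0∞) ^ k = ENNReal.ofReal (3 ^ k) := by
    rw [ENNReal.ofReal_pow (by norm_num), ENNReal.ofReal_ofNat]; rfl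
  rw [h3]
  refine ENNReal.ofReal_le_ofReal ?_
  have hexp : (k : ℝ) ^ k / k.factorial ≤ 3 ^ k := by
    refine (Real.pow_div_factorial_le_exp _ (by positivity) k).trans ?_
    rw [← mul_one (k : ℝ), Real.exp_nat_mul]
    gcongr
    exact Real.exp_one_lt_three.le
  refine le_trans (le_of_eq ?_) hexp
  have hk0 : (k : ℝ) ≠ 0 := by positivity
  have hpow : (k : ℝ) ^ n = k ^ k * k ^ (n - k) := by rw [← pow_add]; congr 1; omega
  push_cast
  rw [hpow]
  field_simp

/-- The upper estimate, given the linear case. -/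
lemma eLpNorm'_eval_le_of_linear (hp : 1 ≤ p) {ρ ν : Measure ℂ} [IsProbabilityMeasure ρ]
    [IsProbabilityMeasure ν] (hρ : IsSymmetricLaw ρ) {K : ℝ≥0} (hK1 : 1 ≤ K)
    (hK : ∀ (n : ℕ) (x : Fin n → X), eLpNorm' (linear x).eval p (Measure.pi fun _ => ν) ≤
        K * eLpNorm' (linear x).eval p (Measure.pi fun _ => ρ))
    {m : ℕ} (P : TetrahedralPolynomial n X) (hP : ∀ A, P A ≠ 0 → A.card ≤ m) :
    eLpNorm' P.eval p (Measure.pi fun _ => ν) ≤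
      ((2 * (3 * K) * contrConst 1 : ℝ≥0) : ℝ≥0∞) ^ m *
        eLpNorm' P.eval p (Measure.pi fun _ => ρ) := by
  have h : P.eval = fun u => ∑ k ∈ Finset.range (m + 1), (1 : ℂ) • (P.homPart k).eval u := by
    ext u
    simp only [one_smul]
    exact eval_eq_sum_homPart P hP u
  have h3K : (1 : ℝ≥0∞) ≤ ((3 * K : ℝ≥0) : ℝ≥0∞) := by
    exact_mod_cast one_le_mul (by norm_num) hK1
  have hk : ∀ k ∈ Finset.range (m + 1), eLpNorm' (P.homPart k).eval p (Measure.pi fun _ => ν) ≤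
      ((3 * K : ℝ≥0) : ℝ≥0∞) ^ m *
        ((contrConst 1 : ℝ≥0∞) ^ m * eLpNorm' P.eval p (Measure.pi fun _ => ρ)) := by
    intro k hk
    have hkm : k ≤ m := Nat.lt_succ_iff.1 (Finset.mem_range.1 hk)
    refine (eLpNorm'_homogeneous_le hp hρ hK (k := k) (P.homPart k) (fun A hA => ?_)).trans
      (mul_le_mul' (pow_le_pow_right₀ h3K hkm) (eLpNorm'_homPart_le hp hρ P hP hkm))
    by_contra h
    exact hA (if_neg h)
  conv_lhs => rw [h]
  refine (eLpNorm'_sum_smul_le hp _ _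
    (fun k _ => (P.homPart k).stronglyMeasurable_eval.aestronglyMeasurable) hk).trans ?_
  -- The m + 1 homogeneous parts are paid for by m + 1 ≤ 2^m, which keeps the constant 1 in degree
  -- 0.
  have h2 : ∑ _k ∈ Finset.range (m + 1), ‖(1 : ℂ)‖ₑ ≤ (2 : ℝ≥0∞) ^ m := by
    simp only [enorm_one, Finset.sum_const, Finset.card_range, nsmul_eq_mul, mul_one]
    exact_mod_cast Nat.lt_two_pow_self (n := m)
  refine (mul_le_mul_left h2 _).trans (le_of_eq ?_)
  push_cast
  simp only [mul_pow]
  ring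

end Homogeneous

/-! ### Reduction to laws -/

lemma polyNorm_eq_eLpNorm' {Ω X : Type*} [MeasurableSpace Ω] [NormedAddCommGroup X]
    [NormedSpace ℂ X] {μ : Measure Ω} [IsProbabilityMeasure μ] {n : ℕ} {ξ : Fin n → Ω → ℂ}
    {ν : Measure ℂ} (hind : iIndepFun ξ μ) (hm : ∀ i, AEMeasurable (ξ i) μ)
    (hlaw : ∀ i, μ.map (ξ i) = ν) (p : ℝ) (P : TetrahedralPolynomial n X) :
    polyNorm μ p P ξ = eLpNorm' P.eval p (Measure.pi fun _ => ν) := by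
  have h := hind.map_fun_eq_pi_map hm
  simp_rw [hlaw] at h
  rw [polyNorm, eLpNorm'_eq_lintegral_enorm, ← h,
    lintegral_map' (P.stronglyMeasurable_eval.enorm.pow_const p).aemeasurable
      (aemeasurable_pi_lambda _ hm)]

lemma IsSteinhausVector.polyNorm_eq {Ω X : Type*} [MeasurableSpace Ω] [NormedAddCommGroup X]
    [NormedSpace ℂ X] {μ : Measure Ω} [IsProbabilityMeasure μ] {n : ℕ} {w : Fin n → Ω → ℂ}
    (hw : IsSteinhausVector μ w) (p : ℝ) (P : TetrahedralPolynomial n X) :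
    polyNorm μ p P w = eLpNorm' P.eval p (Measure.pi fun _ => steinhausLaw) :=
  polyNorm_eq_eLpNorm' hw.1 (fun i => (hw.2 i).aemeasurable) (fun i => (hw.2 i).map_eq) p P

lemma IsIIDCopies.polyNorm_eq {Ω₀ Ω X : Type*} [MeasurableSpace Ω₀] [MeasurableSpace Ω]
    [NormedAddCommGroup X] [NormedSpace ℂ X] {μ₀ : Measure Ω₀} {ξ₀ : Ω₀ → ℂ} {μ : Measure Ω}
    [IsProbabilityMeasure μ] {n : ℕ} {ξ : Fin n → Ω → ℂ} (hξ : IsIIDCopies μ₀ ξ₀ μ ξ) (p : ℝ)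
    (P : TetrahedralPolynomial n X) :
    polyNorm μ p P ξ = eLpNorm' P.eval p (Measure.pi fun _ => μ₀.map ξ₀) :=
  polyNorm_eq_eLpNorm' hξ.1 (fun i => (hξ.2 i).aemeasurable_fst) (fun i => (hξ.2 i).map_eq) p P

lemma IsSymmetricRV.isSymmetricLaw {Ω₀ : Type*} [MeasurableSpace Ω₀] {μ₀ : Measure Ω₀}
    {ξ₀ : Ω₀ → ℂ} (h : IsSymmetricRV μ₀ ξ₀) : IsSymmetricLaw (μ₀.map ξ₀) := by
  refine ⟨measurable_neg, ?_⟩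
  rw [AEMeasurable.map_map_of_aemeasurable measurable_neg.aemeasurable h.aemeasurable_fst]
  exact h.map_eq.symm

end RandomPoly

end

/-! ### Both estimates for random vectors -/

theorem theorem2p2 {X : Type*} [NormedAddCommGroup X] [NormedSpace ℂ X] [CompleteSpace X]
    {Ω₀ : Type*} [MeasurableSpace Ω₀] (μ₀ : Measure Ω₀) [IsProbabilityMeasure μ₀]
    (ξ₀ : Ω₀ → ℂ) (hsymm : RandomPoly.IsSymmetricRV μ₀ ξ₀) (hnontriv : ¬ ξ₀ =ᵐ[μ₀] 0) :
    (∃ C : ℝ≥0, 1 ≤ C ∧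
      ∀ (p : ℝ), 1 ≤ p →
      ∀ (n : ℕ) (P : RandomPoly.TetrahedralPolynomial n X)
        (Ω : Type*) [MeasurableSpace Ω] (μ : Measure Ω) [IsProbabilityMeasure μ]
        (ξ : Fin n → Ω → ℂ)
        (Ω' : Type*) [MeasurableSpace Ω'] (μ' : Measure Ω') [IsProbabilityMeasure μ']
        (w : Fin n → Ω' → ℂ),
        RandomPoly.IsIIDCopies μ₀ ξ₀ μ ξ → RandomPoly.IsSteinhausVector μ' w →
          RandomPoly.polyNorm μ' p P w ≤ (C : ℝ≥0∞) ^ P.degree * RandomPoly.polyNorm μ p P ξ)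
    ∧
    (RandomPoly.HasNontrivialCotype X →
      ∀ s : ℝ, RandomPoly.cot X < s → MemLp ξ₀ (ENNReal.ofReal s) μ₀ →
      ∀ p : ℝ, 1 ≤ p → p < s →
      ∃ C : ℝ≥0, 1 ≤ C ∧
      ∀ (n : ℕ) (P : RandomPoly.TetrahedralPolynomial n X)
        (Ω : Type*) [MeasurableSpace Ω] (μ : Measure Ω) [IsProbabilityMeasure μ]
        (ξ : Fin n → Ω → ℂ)
        (Ω' : Type*) [MeasurableSpace Ω'] (μ' : Measure Ω') [IsProbabilityMeasure μ']
        (w : Fin n → Ω' → ℂ),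
        RandomPoly.IsIIDCopies μ₀ ξ₀ μ ξ → RandomPoly.IsSteinhausVector μ' w →
          RandomPoly.polyNorm μ p P ξ ≤ (C : ℝ≥0∞) ^ P.degree * RandomPoly.polyNorm μ' p P w) := by
  have hm : AEMeasurable ξ₀ μ₀ := hsymm.aemeasurable_fst
  have hprob : IsProbabilityMeasure (μ₀.map ξ₀) := Measure.isProbabilityMeasure_map hm
  have hν := hsymm.isSymmetricLaw
  refine ⟨?_, ?_⟩
  · set δ : ℝ := ∫ z, min ‖z‖ 1 ∂(μ₀.map ξ₀) with hδ
    have hδ0 : 0 < δ := RandomPoly.integral_min_norm_one_pos fun h =>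
      hnontriv (ae_of_ae_map hm h)
    refine ⟨RandomPoly.contrConst (1 / δ) * RandomPoly.contrConst 1 * RandomPoly.contrConst 1,
      one_le_mul (one_le_mul (RandomPoly.one_le_contrConst (by positivity))
        (RandomPoly.one_le_contrConst zero_le_one)) (RandomPoly.one_le_contrConst zero_le_one), ?_⟩
    intro p hp n P Ω _ μ _ ξ Ω' _ μ' _ w hξ hw
    rw [hξ.polyNorm_eq, hw.polyNorm_eq]
    exact RandomPoly.eLpNorm'_eval_unimodular_le hp hν RandomPoly.isSymmetricLaw_steinhausLaw
      RandomPoly.isUnimodularLaw_steinhausLaw hδ0 hδ.symm P fun A hA => P.card_le_degree hA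
  · intro hcot s hXs hs p hp hps
    have hs0 : 0 < s := by linarith
    have hmom : ∫⁻ z, ‖z‖ₑ ^ s ∂(μ₀.map ξ₀) ≠ ∞ := by
      rw [lintegral_map' (measurable_enorm.pow_const s).aemeasurable hm]
      have := lintegral_rpow_enorm_lt_top_of_eLpNorm_lt_top
        (by simpa using hs0) ENNReal.ofReal_ne_top hs.2
      rw [ENNReal.toReal_ofReal hs0.le] at this
      exact this.ne
    obtain ⟨K, hK1, hK⟩ := RandomPoly.exists_linear_le_of_cot_lt hcot hXs hp hps hν hmom
    refine ⟨2 * (3 * K) * RandomPoly.contrConst 1,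
      one_le_mul (one_le_mul (by norm_num) (one_le_mul (by norm_num) hK1))
        (RandomPoly.one_le_contrConst zero_le_one), ?_⟩
    intro n P Ω _ μ _ ξ Ω' _ μ' _ w hξ hw
    rw [hξ.polyNorm_eq, hw.polyNorm_eq]
    exact RandomPoly.eLpNorm'_eval_le_of_linear hp RandomPoly.isSymmetricLaw_steinhausLaw hK1 hK P
      fun A hA => P.card_le_degree hA
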